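/- All Hilbert spaces are finite-dimensional. Alice (system $A$), Bob ($B$) and Eve ($E$) share a state $\rho_{ABE}$; Alice and Bob have two two-outcome measurements $\{N^A_{a|x}\}_a$, $\{N^B_{b|y}\}_b$ ($a,b,x,y\in\{0,1\}$), Eve has one four-outcome measurement $\{N^E_e\}_{e=0,\dots,3}$ (all arbitrary POVMs), and $p(a,b,e|x,y)=\mathrm{Tr}[(N^A_{a|x}\otimes N^B_{b|y}\otimes N^E_e)\rho_{ABE}]$. Write $N^E_{i,j}=N^E_{2i+j}$ for $i,j\in\{0,1\}$, $\mathcal A_x=N^A_{0|x}-N^A_{1|x}$, $\mathcal B_y=N^B_{0|y}-N^B_{1|y}$, and $$\mathcal I=\sum_{i,j=0,1}\Big\langle\big((-1)^{i+j}\mathcal A_0(\mathcal B_0-\mathcal B_1)+(-1)^{i}\mathcal A_1(\mathcal B_0+\mathcal B_1)\big)N^E_{i,j}\Big\rangle ,$$ a linear functional of $p$. Let $|\phi_{i,j}\rangle=\frac1{\sqrt2}\big(|i\,j\rangle+(-1)^i|\bar i\,\bar j\rangle\big)$ with $\bar i=1-i$ be the Bell basis, and $|\phi^+\rangle=|\phi_{0,0}\rangle$.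 Alice and Bob are operationally independent if for every measurement on $A$ and every measurement on $B$ the joint outcome probabilities factorize, $p(a,b)=p(a)\,p(b)$. Theorem. (1) The maximum of $\mathcal I$ over all quantum states and measurements is $2\sqrt2$. (2) It is attained by $|\phi^+_{A\overline A}\rangle\otimes|\phi^+_{B\overline B}\rangle$ with $E=\overline A\,\overline B$, $\mathcal A_0=\sigma_z$, $\mathcal A_1=\sigma_x$, $\mathcal B_0=\frac{\sigma_z+\sigma_x}{\sqrt2}$, $\mathcal B_1=\frac{\sigma_x-\sigma_z}{\sqrt2}$ and $N^E_{i,j}=|\phi_{i,j}\rangle\langle\phi_{i,j}|$; in this state Alice and Bob are operationally independent. (3) Suppose that the joint state is pure, $\rho_{ABE}=|\psi\rangle\langle\psi|$, that its local states $\rho_A,\rho_B,\rho_E$ have full rank, that Alice and Bob are operationally independent, and that $\mathcal I=2\sqrt2$. Then there is a unitary identification $V:\mathcal H_E\to\mathcal H_{\overline A}\otimes\mathcal H_{\overline B}$ under which $|\psi\rangle$ becomes a product $|\psi_{A\overline A}\rangle\otimes|\psi_{B\overline B}\rangle$ of two normalized source states. Moreover, for every such identification there are, for $s=A,B$, junk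 Hilbert spaces $\mathcal H_{s''},\mathcal H_{\overline s''}$, unitaries $U_s:\mathcal H_s\to\mathbb C^2\otimes\mathcal H_{s''}$ and $U_{\overline s}:\mathcal H_{\overline s}\to\mathbb C^2\otimes\mathcal H_{\overline s''}$, and a normalized junk state $|\xi_{s''\overline s''}\rangle$ such that $$(U_s\otimes U_{\overline s})|\psi_{s\overline s}\rangle=|\phi^+_{s'\overline s'}\rangle\otimes|\xi_{s''\overline s''}\rangle ,$$ $$U_A\mathcal A_0U_A^\dagger=\sigma_z\otimes\mathbb 1,\quad U_A\mathcal A_1U_A^\dagger=\sigma_x\otimes\mathbb 1,\quad U_B\mathcal B_0U_B^\dagger=\tfrac{\sigma_z+\sigma_x}{\sqrt2}\otimes\mathbb 1,\quad U_B\mathcal B_1U_B^\dagger=\tfrac{\sigma_x-\sigma_z}{\sqrt2}\otimes\mathbb 1,$$ $$\overline U\,N^E_{i,j}\,\overline U^\dagger=|\phi_{i,j}\rangle\langle\phi_{i,j}|\otimes\mathbb 1\quad(i,j=0,1),\qquad \overline U=(U_{\overline A}\otimes U_{\overline B})V ,$$ where $|\phi_{i,j}\rangle$ lives on the two qubits $\overline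 A'\,\overline B'$ and $\mathbb 1$ acts on $\mathcal H_{\overline A''}\otimes\mathcal H_{\overline B''}$, and $s',\overline s'$ denote the qubits $\mathbb C^2$. -/

import Mathlib

open scoped Matrix Kronecker ComplexOrder

/-! ## Finite-dimensional quantum mechanics in coordinates

A finite-dimensional Hilbert space is `ℂ^α` for a finite index type `α`, the tensor product of
`ℂ^α` and `ℂ^β` is `ℂ^(α × β)`, and operators are matrices, with `⊗ₖ` as their tensor product. -/

noncomputable section

namespace WeakBilocality

/-- A density matrix. -/
def IsState {ι : Type*} [Fintype ι] (ρ : Matrix ι ι ℂ) : Prop :=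
  ρ.PosSemidef ∧ ρ.trace = 1

/-- A unit vector for the Hermitian norm. -/
def IsUnitVec {ι : Type*} [Fintype ι] (ψ : ι → ℂ) : Prop :=
  ∑ k, ‖ψ k‖ ^ 2 = 1

/-- The rank-one operator `|ψ⟩⟨ψ|`. -/
def ketbra {ι : Type*} (ψ : ι → ℂ) : Matrix ι ι ℂ :=
  Matrix.vecMulVec ψ (star ψ)

/-- A measurement with outcome set `κ`, given by its measurement elements. -/
def IsPOVM {κ ι : Type*} [Fintype κ] [DecidableEq ι] (M : κ → Matrix ι ι ℂ) : Prop :=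
  (∀ k, (M k).PosSemidef) ∧ ∑ k, M k = 1

/-- A unitary operator from `ℂ^ι` onto `ℂ^κ`. -/
def IsUnitaryMap {κ ι : Type*} [Fintype κ] [Fintype ι] [DecidableEq κ] [DecidableEq ι]
    (U : Matrix κ ι ℂ) : Prop :=
  U * Uᴴ = 1 ∧ Uᴴ * U = 1

/-- The tensor product of two vectors. -/
def tensorVec {ι κ : Type*} (v : ι → ℂ) (w : κ → ℂ) : ι × κ → ℂ :=
  fun p => v p.1 * w p.2

/-! ### Local states of a state on `A ⊗ B ⊗ E` -/

section Reduced
variable {α β ε : Type*} [Fintype α] [Fintype β] [Fintype ε]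

/-- Alice's local state `ρ_A = Tr_{BE} ρ`. -/
def reducedA (ρ : Matrix (α × β × ε) (α × β × ε) ℂ) : Matrix α α ℂ :=
  fun a a' => ∑ b, ∑ e, ρ (a, b, e) (a', b, e)

/-- Bob's local state `ρ_B = Tr_{AE} ρ`. -/
def reducedB (ρ : Matrix (α × β × ε) (α × β × ε) ℂ) : Matrix β β ℂ :=
  fun b b' => ∑ a, ∑ e, ρ (a, b, e) (a, b', e)

/-- Eve's local state `ρ_E = Tr_{AB} ρ`. -/
def reducedE (ρ : Matrix (α × β × ε) (α × β × ε) ℂ) : Matrix ε ε ℂ :=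
  fun e e' => ∑ a, ∑ b, ρ (a, b, e) (a, b, e')

/-- All three local states have full rank. -/
def LocallyFullRank (ρ : Matrix (α × β × ε) (α × β × ε) ℂ) : Prop :=
  (reducedA ρ).PosDef ∧ (reducedB ρ).PosDef ∧ (reducedE ρ).PosDef

end Reduced

/-! ### Measurement devices, correlations, and the functional -/

/-- The measurement elements of the three parties: `NA x a`, `NB y b` and `NE e` are
`N^A_{a|x}`, `N^B_{b|y}` and `N^E_e`. -/
structure Devices (α β ε : Type*) where
  NA : Fin 2 → Fin 2 → Matrix α α ℂ
  NB : Fin 2 → Fin 2 → Matrix β β ℂ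
  NE : Fin 4 → Matrix ε ε ℂ

/-- The outcome `e = 2i + j` of Eve. -/
def eveOutcome : Fin 2 × Fin 2 ≃ Fin 4 :=
  (finProdFinEquiv : Fin 2 × Fin 2 ≃ Fin (2 * 2))

section Scenario
variable {α β ε : Type*}

/-- The measurement elements form measurements. -/
def Devices.IsValid [DecidableEq α] [DecidableEq β] [DecidableEq ε]
    (D : Devices α β ε) : Prop :=
  (∀ x, IsPOVM (D.NA x)) ∧ (∀ y, IsPOVM (D.NB y)) ∧ IsPOVM D.NE

/-- Alice's observable `A_x = N^A_{0|x} - N^A_{1|x}`. -/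
def Devices.obsA (D : Devices α β ε) (x : Fin 2) : Matrix α α ℂ := D.NA x 0 - D.NA x 1

/-- Bob's observable `B_y = N^B_{0|y} - N^B_{1|y}`. -/
def Devices.obsB (D : Devices α β ε) (y : Fin 2) : Matrix β β ℂ := D.NB y 0 - D.NB y 1

variable [Fintype α] [Fintype β] [Fintype ε]

/-- The Born rule `Tr[(X ⊗ Y ⊗ Z) ρ]`. -/
def born (ρ : Matrix (α × β × ε) (α × β × ε) ℂ)
    (X : Matrix α α ℂ) (Y : Matrix β β ℂ) (Z : Matrix ε ε ℂ) : ℝ :=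
  (((X ⊗ₖ (Y ⊗ₖ Z)) * ρ).trace).re

/-- The correlations `p a b e x y = p(a,b,e|x,y)` that a state and devices generate. -/
def correlations (ρ : Matrix (α × β × ε) (α × β × ε) ℂ) (D : Devices α β ε)
    (a b : Fin 2) (e : Fin 4) (x y : Fin 2) : ℝ :=
  born ρ (D.NA x a) (D.NB y b) (D.NE e)

/-- Operational independence of Alice and Bob: for all measurements (not only those of the
devices), with any finite numbers of outcomes, the joint probabilities of their outcomes
factorize. -/
def OperationallyIndependent [DecidableEq α] [DecidableEq β] [DecidableEq ε]
    (ρ : Matrix (α × β × ε) (α × β × ε) ℂ) : Prop :=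
  ∀ (m n : ℕ) (M : Fin m → Matrix α α ℂ) (N : Fin n → Matrix β β ℂ), IsPOVM M → IsPOVM N →
    ∀ a b, born ρ (M a) (N b) 1 = born ρ (M a) 1 1 * born ρ 1 (N b) 1

end Scenario

/-- The expectation value `⟨A_x B_y N^E_e⟩` in terms of the correlations. -/
def expectation (p : Fin 2 → Fin 2 → Fin 4 → Fin 2 → Fin 2 → ℝ) (x y : Fin 2) (e : Fin 4) : ℝ :=
  p 0 0 e x y + p 1 1 e x y - p 0 1 e x y - p 1 0 e x y

/-- The functional `⟨A₀ (B₀ - B₁) E₀ + A₁ (B₀ + B₁) E₁⟩` with `E₀ = N₀ - N₁ - N₂ + N₃` and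
`E₁ = N₀ + N₁ - N₂ - N₃`. -/
def functionalI (p : Fin 2 → Fin 2 → Fin 4 → Fin 2 → Fin 2 → ℝ) : ℝ :=
  ∑ e, ((![1, -1, -1, 1] : Fin 4 → ℝ) e * (expectation p 0 0 e - expectation p 0 1 e)
    + (![1, 1, -1, -1] : Fin 4 → ℝ) e * (expectation p 1 0 e + expectation p 1 1 e))

/-- The quantum correlations: those of some state (possibly mixed, with possibly correlated
sources) and some measurements, in any finite dimensions. -/
def quantumCorrelations : Set (Fin 2 → Fin 2 → Fin 4 → Fin 2 → Fin 2 → ℝ) :=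
  {p | ∃ (dA dB dE : ℕ)
    (ρ : Matrix (Fin dA × Fin dB × Fin dE) (Fin dA × Fin dB × Fin dE) ℂ)
    (D : Devices (Fin dA) (Fin dB) (Fin dE)),
    IsState ρ ∧ D.IsValid ∧ p = correlations ρ D}

/-! ### The ideal states and measurements -/

/-- The Pauli matrix `σ_z`. -/
def σz : Matrix (Fin 2) (Fin 2) ℂ := !![1, 0; 0, -1]

/-- The Pauli matrix `σ_x`. -/
def σx : Matrix (Fin 2) (Fin 2) ℂ := !![0, 1; 1, 0]

/-- `A₀ = σ_z`, `A₁ = σ_x`. -/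
def idealA : Fin 2 → Matrix (Fin 2) (Fin 2) ℂ := ![σz, σx]

/-- `B₀ = (σ_z + σ_x)/√2`, `B₁ = (σ_x - σ_z)/√2`. -/
def idealB : Fin 2 → Matrix (Fin 2) (Fin 2) ℂ :=
  ![((√2 : ℝ) : ℂ)⁻¹ • (σz + σx), ((√2 : ℝ) : ℂ)⁻¹ • (σx - σz)]

/-- The Bell basis `|φ_{i,j}⟩ = (|i j⟩ + (-1)^i |(1-i) (1-j)⟩)/√2`. -/
def bellVec (i j : Fin 2) : Fin 2 × Fin 2 → ℂ :=
  ((√2 : ℝ) : ℂ)⁻¹ •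
    (Pi.single (i, j) 1 + (-1 : ℂ) ^ (i : ℕ) • Pi.single (1 - i, 1 - j) 1)

/-- The maximally entangled state `|φ⁺⟩ = (|00⟩ + |11⟩)/√2`. -/
def phiPlus : Fin 2 × Fin 2 → ℂ :=
  ((√2 : ℝ) : ℂ)⁻¹ • (Pi.single (0, 0) 1 + Pi.single (1, 1) 1)

/-- The joint vector `|χ_{A Ā}⟩ ⊗ |χ_{B B̄}⟩` of two independent sources, with
the systems in the order `A, B, Ā, B̄`. -/
def sourcesVec {α β αb βb : Type*} (χA : α × αb → ℂ) (χB : β × βb → ℂ) :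
    α × β × αb × βb → ℂ :=
  fun t => χA (t.1, t.2.2.1) * χB (t.2.1, t.2.2.2)

/-- The state of two maximally entangled pairs. -/
def idealState : Matrix (Fin 2 × Fin 2 × Fin 2 × Fin 2) (Fin 2 × Fin 2 × Fin 2 × Fin 2) ℂ :=
  ketbra (sourcesVec phiPlus phiPlus)

/-- The ideal devices: `N_{a|x} = (1 + (-1)^a O_x)/2` for the ideal observables `O_x`, and the
Bell-basis projections. -/
def idealDevices : Devices (Fin 2) (Fin 2) (Fin 2 × Fin 2) where
  NA x a := (2⁻¹ : ℂ) • (1 + (-1 : ℂ) ^ (a : ℕ) • idealA x)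
  NB y b := (2⁻¹ : ℂ) • (1 + (-1 : ℂ) ^ (b : ℕ) • idealB y)
  NE e := ketbra (bellVec (eveOutcome.symm e).1 (eveOutcome.symm e).2)

/-! ### The certification -/

section Certification
variable {α β ε αb βb : Type*} [Fintype α] [Fintype β] [Fintype ε] [Fintype αb] [Fintype βb]
  [DecidableEq α] [DecidableEq β] [DecidableEq ε] [DecidableEq αb] [DecidableEq βb]

/-- `V` identifies Eve's Hilbert space with `Ā ⊗ B̄` in such a way that the joint vector `ψ`
becomes the product `|χ_{A Ā}⟩ ⊗ |χ_{B B̄}⟩` of two source states. -/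
def IsSourceSplitting (ψ : α × β × ε → ℂ) (V : Matrix (αb × βb) ε ℂ)
    (χA : α × αb → ℂ) (χB : β × βb → ℂ) : Prop :=
  IsUnitaryMap V ∧ IsUnitVec χA ∧ IsUnitVec χB ∧
    ((1 : Matrix α α ℂ) ⊗ₖ ((1 : Matrix β β ℂ) ⊗ₖ V)) *ᵥ ψ = sourcesVec χA χB

/-- Certification of one source and of the receiving party `s`, up to the unitaries `U` on `s` and
`Ub` on `s̄` and junk spaces `ℂ^m`, `ℂ^n`: the source state is `|φ⁺⟩ ⊗ |ξ⟩` and the observables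
`O x` are `T x ⊗ 1`. -/
def CertifiesSource {m n : ℕ} (χ : α × αb → ℂ) (O : Fin 2 → Matrix α α ℂ)
    (T : Fin 2 → Matrix (Fin 2) (Fin 2) ℂ)
    (U : Matrix (Fin 2 × Fin m) α ℂ) (Ub : Matrix (Fin 2 × Fin n) αb ℂ) : Prop :=
  IsUnitaryMap U ∧ IsUnitaryMap Ub ∧
  (∃ ξ : Fin m × Fin n → ℂ, IsUnitVec ξ ∧
    (U ⊗ₖ Ub) *ᵥ χ =
      tensorVec phiPlus ξ ∘ Equiv.prodProdProdComm (Fin 2) (Fin m) (Fin 2) (Fin n)) ∧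
  ∀ x, U * O x * Uᴴ = T x ⊗ₖ (1 : Matrix (Fin m) (Fin m) ℂ)

/-- Certification of Eve's measurement: after the identification of her space with `Ā ⊗ B̄` by `V`
and the unitary `UAb ⊗ UBb`, its elements are `|φ_{i,j}⟩⟨φ_{i,j}| ⊗ 1`, where the two qubits of
`Ā` and `B̄` come first and the two junk systems last. -/
def CertifiesEve {m n : ℕ} (NE : Fin 4 → Matrix ε ε ℂ) (V : Matrix (αb × βb) ε ℂ)
    (UAb : Matrix (Fin 2 × Fin m) αb ℂ) (UBb : Matrix (Fin 2 × Fin n) βb ℂ) : Prop :=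
  ∀ i j, ((UAb ⊗ₖ UBb) * V) * NE (eveOutcome (i, j)) * ((UAb ⊗ₖ UBb) * V)ᴴ =
    (ketbra (bellVec i j) ⊗ₖ (1 : Matrix (Fin m × Fin n) (Fin m × Fin n) ℂ)).submatrix
      (Equiv.prodProdProdComm (Fin 2) (Fin m) (Fin 2) (Fin n))
      (Equiv.prodProdProdComm (Fin 2) (Fin m) (Fin 2) (Fin n))

end Certification

end WeakBilocality

end

set_option linter.unusedSectionVars false

open scoped Matrix Kronecker ComplexOrder

/-! The bound is a sum-of-squares certificate. For each outcome `e` of Eve, with signs s, t, the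
operators √2 A₀ − s(B₀ − B₁) and √2 A₁ − t(B₀ + B₁) commute with Eve's element. Their squares,
weighted by that element and summed over `e`, add up with the slack terms 2(1 − A²), 2(1 − B²) to 8
− 2√2 I (`sum_of_squares`, `bound_decomposition`). Every term is nonnegative, so I ≤ 2√2.

At equality every term vanishes on the state (`saturation`). Full local rank turns an identity
"local operator times ρ = 0" into an operator identity. Hence the observables are involutions, as
are Z = (B₀ − B₁)/√2 and X = (B₀ + B₁)/√2. The pair Z, X anticommutes because B₀² = B₁², and the
state transfers this to A₀, A₁. Eve's signed sums F, G of measurement elements mirror A₀Z and A₁X on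
the state, and they determine her measurement as (1 + sF)(1 + tG)/4
(`idealRelations_of_saturation`).

Operational independence makes ρ_AB a product (`product_of_operationallyIndependent`). A product of
purifications of ρ_A and ρ_B then purifies the same state, so the two purifications differ by a
unitary on Eve's side (`exists_isSourceSplitting`).

For an arbitrary splitting, conjugation by A₀ ⊗ Z and by A₁ ⊗ X preserves ρ_A ⊗ ρ_B, so each factor
commutes with its local state (`commute_of_kronecker_invariant`). Conjugating by the invertible
coefficient matrix of a source therefore carries the local anticommuting pair to a Hermitian
anticommuting pair on the far side. In Pauli coordinates on both sides the coefficient matrix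
intertwines the Paulis, so it has the form 1 ⊗ S: a maximally entangled pair times junk
(`exists_source_form`). In these coordinates F and G become σz ⊗ σz and σx ⊗ σx, and the formula for
Eve's elements gives the Bell projections (`mirrored_operator`, `bell_projection`). -/

namespace WeakBilocality

/-! ### Local operators on the joint system, and faithfulness of full-rank local states. -/

section Operators
variable {α β ε : Type*} [Fintype α] [Fintype β] [Fintype ε]
  [DecidableEq α] [DecidableEq β] [DecidableEq ε]

/-- An operator of Alice, acting on the joint system. -/
def opA (β ε : Type*) [DecidableEq β] [DecidableEq ε] (X : Matrix α α ℂ) :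
    Matrix (α × β × ε) (α × β × ε) ℂ :=
  X ⊗ₖ ((1 : Matrix β β ℂ) ⊗ₖ (1 : Matrix ε ε ℂ))

/-- An operator of Bob, acting on the joint system. -/
def opB (α ε : Type*) [DecidableEq α] [DecidableEq ε] (Y : Matrix β β ℂ) :
    Matrix (α × β × ε) (α × β × ε) ℂ :=
  (1 : Matrix α α ℂ) ⊗ₖ (Y ⊗ₖ (1 : Matrix ε ε ℂ))

/-- An operator of Eve, acting on the joint system. -/
def opE (α β : Type*) [DecidableEq α] [DecidableEq β] (Z : Matrix ε ε ℂ) :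
    Matrix (α × β × ε) (α × β × ε) ℂ :=
  (1 : Matrix α α ℂ) ⊗ₖ ((1 : Matrix β β ℂ) ⊗ₖ Z)

lemma opA_mul_opB_mul_opE (X : Matrix α α ℂ) (Y : Matrix β β ℂ) (Z : Matrix ε ε ℂ) :
    opA β ε X * opB α ε Y * opE α β Z = X ⊗ₖ (Y ⊗ₖ Z) := by
  simp [opA, opB, opE, ← Matrix.mul_kronecker_mul]

lemma opA_mul (X Y : Matrix α α ℂ) : opA β ε (X * Y) = opA β ε X * opA β ε Y := by
  simp [opA, ← Matrix.mul_kronecker_mul]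

lemma opB_mul (X Y : Matrix β β ℂ) : opB α ε (X * Y) = opB α ε X * opB α ε Y := by
  simp [opB, ← Matrix.mul_kronecker_mul]

lemma opE_mul (X Y : Matrix ε ε ℂ) : opE α β (X * Y) = opE α β X * opE α β Y := by
  simp [opE, ← Matrix.mul_kronecker_mul]

lemma opA_sub (X Y : Matrix α α ℂ) : opA β ε (X - Y) = opA β ε X - opA β ε Y := by
  ext ⟨a, b, e⟩ ⟨a', b', e'⟩; simp [opA, sub_mul]

lemma opA_add (X Y : Matrix α α ℂ) : opA β ε (X + Y) = opA β ε X + opA β ε Y := by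
  ext ⟨a, b, e⟩ ⟨a', b', e'⟩; simp [opA, add_mul]

lemma opB_sub (X Y : Matrix β β ℂ) : opB α ε (X - Y) = opB α ε X - opB α ε Y := by
  ext ⟨a, b, e⟩ ⟨a', b', e'⟩; simp [opB, sub_mul, mul_sub]

lemma opB_add (X Y : Matrix β β ℂ) : opB α ε (X + Y) = opB α ε X + opB α ε Y := by
  ext ⟨a, b, e⟩ ⟨a', b', e'⟩; simp [opB, add_mul, mul_add]

lemma opB_smul (r : ℝ) (X : Matrix β β ℂ) : opB α ε (r • X) = r • opB α ε X := by
  simp [opB, Matrix.smul_kronecker, Matrix.kronecker_smul]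

lemma opE_sub (X Y : Matrix ε ε ℂ) : opE α β (X - Y) = opE α β X - opE α β Y := by
  ext ⟨a, b, e⟩ ⟨a', b', e'⟩; simp [opE, mul_sub]

lemma opE_smul (r : ℝ) (X : Matrix ε ε ℂ) : opE α β (r • X) = r • opE α β X := by
  simp [opE, Matrix.kronecker_smul]

lemma opE_sum {ι : Type*} (s : Finset ι) (X : ι → Matrix ε ε ℂ) :
    opE α β (∑ k ∈ s, X k) = ∑ k ∈ s, opE α β (X k) := by
  ext ⟨a, b, e⟩ ⟨a', b', e'⟩; simp [opE, Matrix.sum_apply, Finset.mul_sum]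

lemma opA_one : opA β ε (1 : Matrix α α ℂ) = 1 := by simp [opA]
lemma opB_one : opB α ε (1 : Matrix β β ℂ) = 1 := by simp [opB]
lemma opE_one : opE α β (1 : Matrix ε ε ℂ) = 1 := by simp [opE]

lemma commute_opA_opB (X : Matrix α α ℂ) (Y : Matrix β β ℂ) :
    Commute (opA β ε X) (opB α ε Y) := by
  simp [Commute, SemiconjBy, opA, opB, ← Matrix.mul_kronecker_mul]

lemma commute_opA_opE (X : Matrix α α ℂ) (Z : Matrix ε ε ℂ) :
    Commute (opA β ε X) (opE α β Z) := by
  simp [Commute, SemiconjBy, opA, opE, ← Matrix.mul_kronecker_mul]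

lemma commute_opB_opE (Y : Matrix β β ℂ) (Z : Matrix ε ε ℂ) :
    Commute (opB α ε Y) (opE α β Z) := by
  simp [Commute, SemiconjBy, opB, opE, ← Matrix.mul_kronecker_mul]

lemma _root_.Matrix.IsHermitian.opA {X : Matrix α α ℂ} (h : X.IsHermitian) :
    (opA β ε X).IsHermitian := by
  simp [Matrix.IsHermitian, WeakBilocality.opA, Matrix.conjTranspose_kronecker, h.eq]

lemma _root_.Matrix.IsHermitian.opB {X : Matrix β β ℂ} (h : X.IsHermitian) :
    (opB α ε X).IsHermitian := by
  simp [Matrix.IsHermitian, WeakBilocality.opB, Matrix.conjTranspose_kronecker, h.eq]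

lemma _root_.Matrix.PosSemidef.opA {X : Matrix α α ℂ} (h : X.PosSemidef) :
    (opA β ε X).PosSemidef :=
  h.kronecker (Matrix.PosSemidef.one.kronecker Matrix.PosSemidef.one)

lemma _root_.Matrix.PosSemidef.opB {X : Matrix β β ℂ} (h : X.PosSemidef) :
    (opB α ε X).PosSemidef :=
  Matrix.PosSemidef.one.kronecker (h.kronecker Matrix.PosSemidef.one)

lemma _root_.Matrix.PosSemidef.opE {X : Matrix ε ε ℂ} (h : X.PosSemidef) :
    (opE α β X).PosSemidef :=
  Matrix.PosSemidef.one.kronecker (Matrix.PosSemidef.one.kronecker h)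

/-- Tracing out the other two systems leaves `X * reducedA ρ = 0`, and a positive definite matrix
can be cancelled. This and its analogues for Bob and Eve are the only way full rank is used to
obtain the operator relations. -/
lemma eq_zero_of_opA_mul_eq_zero {ρ : Matrix (α × β × ε) (α × β × ε) ℂ}
    (hρ : (reducedA ρ).PosDef) {X : Matrix α α ℂ} (h : opA β ε X * ρ = 0) : X = 0 := by
  have key : X * reducedA ρ = 0 := by
    ext a a'
    have := fun b e => congrFun (congrFun h (a, b, e)) (a', b, e)
    simp only [opA, Matrix.mul_apply, Fintype.sum_prod_type, Matrix.kroneckerMap_apply,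
      Matrix.one_apply, mul_ite, mul_one, mul_zero, ite_mul, zero_mul, Finset.sum_ite_eq,
      Finset.mem_univ, if_true, Matrix.zero_apply] at this
    simp only [Matrix.mul_apply, reducedA, Finset.mul_sum, Matrix.zero_apply]
    rw [Finset.sum_comm]
    refine Finset.sum_eq_zero fun b _ => ?_
    rw [Finset.sum_comm]
    exact Finset.sum_eq_zero fun e _ => this b e
  exact hρ.isUnit.mul_left_eq_zero.mp key

lemma eq_zero_of_opB_mul_eq_zero {ρ : Matrix (α × β × ε) (α × β × ε) ℂ}
    (hρ : (reducedB ρ).PosDef) {X : Matrix β β ℂ} (h : opB α ε X * ρ = 0) : X = 0 := by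
  have key : X * reducedB ρ = 0 := by
    ext b b'
    have := fun a e => congrFun (congrFun h (a, b, e)) (a, b', e)
    simp only [opB, Matrix.mul_apply, Fintype.sum_prod_type, Matrix.kroneckerMap_apply,
      Matrix.one_apply, mul_ite, mul_one, mul_zero, ite_mul, zero_mul, one_mul, Finset.sum_ite_eq,
      Finset.mem_univ, if_true, Matrix.zero_apply, Finset.sum_ite_irrel,
      Finset.sum_const_zero] at this
    simp only [Matrix.mul_apply, reducedB, Finset.mul_sum, Matrix.zero_apply]
    rw [Finset.sum_comm]
    refine Finset.sum_eq_zero fun a _ => ?_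
    rw [Finset.sum_comm]
    exact Finset.sum_eq_zero fun e _ => this a e
  exact hρ.isUnit.mul_left_eq_zero.mp key

lemma eq_zero_of_opE_mul_eq_zero {ρ : Matrix (α × β × ε) (α × β × ε) ℂ}
    (hρ : (reducedE ρ).PosDef) {X : Matrix ε ε ℂ} (h : opE α β X * ρ = 0) : X = 0 := by
  have key : X * reducedE ρ = 0 := by
    ext e e'
    have := fun a b => congrFun (congrFun h (a, b, e)) (a, b, e')
    simp only [opE, Matrix.mul_apply, Fintype.sum_prod_type, Matrix.kroneckerMap_apply,
      Matrix.one_apply, mul_ite, mul_zero, ite_mul, zero_mul, one_mul, Finset.sum_ite_eq,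
      Finset.mem_univ, if_true, Matrix.zero_apply, Finset.sum_ite_irrel,
      Finset.sum_const_zero] at this
    simp only [Matrix.mul_apply, reducedE, Finset.mul_sum, Matrix.zero_apply]
    rw [Finset.sum_comm]
    refine Finset.sum_eq_zero fun a _ => ?_
    rw [Finset.sum_comm]
    exact Finset.sum_eq_zero fun b _ => this a b
  exact hρ.isUnit.mul_left_eq_zero.mp key

end Operators

/-! ### Vanishing expectations of positive operators. -/

section Trace
variable {ι : Type*} [Fintype ι]

open scoped MatrixOrder in
lemma exists_eq_conjTranspose_mul_self {K : Matrix ι ι ℂ} (hK : K.PosSemidef) :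
    ∃ C : Matrix ι ι ℂ, K = Cᴴ * C := by
  classical
  exact CStarAlgebra.nonneg_iff_eq_star_mul_self.mp hK.nonneg

lemma re_trace_nonneg {K ρ : Matrix ι ι ℂ} (hK : K.PosSemidef) (hρ : ρ.PosSemidef) :
    0 ≤ (K * ρ).trace.re := by
  classical
  obtain ⟨C, rfl⟩ := exists_eq_conjTranspose_mul_self hρ
  rw [← Matrix.mul_assoc, Matrix.trace_mul_comm, ← Matrix.mul_assoc]
  exact (Complex.le_def.mp (hK.mul_mul_conjTranspose_same C).trace_nonneg).1

lemma mul_eq_zero_of_re_trace_eq_zero {K ρ : Matrix ι ι ℂ} (hK : K.PosSemidef)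
    (hρ : ρ.PosSemidef) (h : (K * ρ).trace.re = 0) : K * ρ = 0 := by
  classical
  obtain ⟨C, rfl⟩ := exists_eq_conjTranspose_mul_self hρ
  obtain ⟨D, rfl⟩ := exists_eq_conjTranspose_mul_self hK
  have e : (Dᴴ * D * (Cᴴ * C)).trace = ((D * Cᴴ)ᴴ * (D * Cᴴ)).trace := by
    rw [← Matrix.mul_assoc, Matrix.trace_mul_comm]
    simp [Matrix.mul_assoc]
  have h0 : ((D * Cᴴ)ᴴ * (D * Cᴴ)).trace = 0 := by
    have := (Matrix.posSemidef_conjTranspose_mul_self (D * Cᴴ)).trace_nonneg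
    rw [e] at h
    exact Complex.ext h (Complex.le_def.mp this).2.symm
  rw [Matrix.trace_conjTranspose_mul_self_eq_zero_iff] at h0
  rw [Matrix.mul_assoc, ← Matrix.mul_assoc D, h0]
  simp

/-- Write n = D†D. Zero expectation of (DP)†(DP) forces DPρ = 0, and D† is then restored on the
left. The outer `P` is thereby removed, which leaves a relation linear in the defect operator. -/
lemma mul_mul_eq_zero_of_re_trace_eq_zero {n P ρ : Matrix ι ι ℂ} (hn : n.PosSemidef)
    (hP : P.IsHermitian) (hρ : ρ.PosSemidef) (h : (P * n * P * ρ).trace.re = 0) :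
    n * P * ρ = 0 := by
  classical
  have hK : (P * n * P).PosSemidef := by simpa [hP.eq] using hn.conjTranspose_mul_mul_same P
  have h0 := mul_eq_zero_of_re_trace_eq_zero hK hρ h
  obtain ⟨D, rfl⟩ := exists_eq_conjTranspose_mul_self hn
  have e : (D * P)ᴴ * (D * P) * ρ = 0 := by
    rw [← h0, Matrix.conjTranspose_mul, hP.eq]; simp only [Matrix.mul_assoc]
  rw [Matrix.conjTranspose_mul_self_mul_eq_zero] at e
  rw [Matrix.mul_assoc, Matrix.mul_assoc, ← Matrix.mul_assoc D, e, Matrix.mul_zero]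

end Trace

/-! ### The sum-of-squares identity and the quantum bound. -/

lemma isHermitian_real_smul {ι : Type*} (r : ℝ) {X : Matrix ι ι ℂ} (hX : X.IsHermitian) :
    (r • X).IsHermitian := by
  simp [Matrix.IsHermitian, Matrix.conjTranspose_smul, hX.eq]

lemma posSemidef_one_sub_observable_sq {ι : Type*} [Fintype ι] [DecidableEq ι]
    {M : Fin 2 → Matrix ι ι ℂ} (hM : IsPOVM M) :
    (1 - (M 0 - M 1) * (M 0 - M 1)).PosSemidef := by
  have h1 : M 1 = 1 - M 0 := by rw [← hM.2, Fin.sum_univ_two]; abel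
  -- The left side is 4 M₀M₁. Since M₀ and M₁ commute and sum to 1, M₀M₁ = M₀M₁M₀ + M₁M₀M₁, which is
  -- visibly positive.
  have e : 1 - (M 0 - M 1) * (M 0 - M 1) =
      (4 : ℝ) • ((M 0)ᴴ * M 1 * M 0 + (M 1)ᴴ * M 0 * M 1) := by
    rw [(hM.1 0).isHermitian.eq, (hM.1 1).isHermitian.eq, h1]
    simp only [mul_sub, sub_mul, mul_one, one_mul]
    module
  rw [e]
  have := ((hM.1 1).conjTranspose_mul_mul_same (M 0)).add
    ((hM.1 0).conjTranspose_mul_mul_same (M 1))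
  exact this.smul (show (0 : ℝ) ≤ 4 by norm_num)

/-- The products b₀b₁ and b₁b₀ cancel between the two squares, leaving twice each of the four
squared observables. The slack terms replace these by the constant 8. -/
lemma sum_of_squares {R : Type*} [Ring R] [Algebra ℝ R] {a₀ a₁ b₀ b₁ n : R} {r s t : ℝ}
    (hr : r * r = 2) (hs : s * s = 1) (ht : t * t = 1)
    (h00 : Commute a₀ b₀) (h01 : Commute a₀ b₁) (h10 : Commute a₁ b₀) (h11 : Commute a₁ b₁)
    (ha₀ : Commute a₀ n) (ha₁ : Commute a₁ n) (hb₀ : Commute b₀ n) (hb₁ : Commute b₁ n) :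
    (r • a₀ - s • (b₀ - b₁)) * n * (r • a₀ - s • (b₀ - b₁)) +
      (r • a₁ - t • (b₀ + b₁)) * n * (r • a₁ - t • (b₀ + b₁)) +
      (2 : ℝ) • ((1 - a₀ * a₀ + (1 - a₁ * a₁) + (1 - b₀ * b₀) + (1 - b₁ * b₁)) * n) =
    (8 : ℝ) • n - (2 * r) • ((s • (a₀ * (b₀ - b₁)) + t • (a₁ * (b₀ + b₁))) * n) := by
  have hP : Commute (r • a₀ - s • (b₀ - b₁)) n :=
    (ha₀.smul_left r).sub_left ((hb₀.sub_left hb₁).smul_left s)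
  have hQ : Commute (r • a₁ - t • (b₀ + b₁)) n :=
    (ha₁.smul_left r).sub_left ((hb₀.add_left hb₁).smul_left t)
  -- Everything is brought to the form (coefficient) * `n`; the coefficient is then shown to vanish.
  rw [mul_assoc, ← hP.eq, mul_assoc _ n, ← hQ.eq, ← mul_assoc, ← mul_assoc, ← add_mul,
    ← smul_mul_assoc, ← add_mul, ← smul_mul_assoc, ← sub_eq_zero, ← one_mul n, ← smul_mul_assoc,
    one_mul n, ← sub_mul, ← sub_mul]
  convert zero_mul n
  simp only [mul_sub, sub_mul, mul_add, add_mul, smul_mul_assoc, mul_smul_comm, ← h00.eq,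
    ← h01.eq, ← h10.eq, ← h11.eq, smul_sub, smul_add, smul_smul, hr, hs, ht]
  module

section Bound
variable {α β ε : Type*} [Fintype α] [Fintype β] [Fintype ε]
  [DecidableEq α] [DecidableEq β] [DecidableEq ε]

/-- The sign with which `A₀ (B₀ - B₁) N_e` enters the functional. -/
def signZ : Fin 4 → ℝ := ![1, -1, -1, 1]

/-- The sign with which `A₁ (B₀ + B₁) N_e` enters the functional. -/
def signX : Fin 4 → ℝ := ![1, 1, -1, -1]

lemma signZ_mul_self (e : Fin 4) : signZ e * signZ e = 1 := by fin_cases e <;> simp [signZ]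
lemma signX_mul_self (e : Fin 4) : signX e * signX e = 1 := by fin_cases e <;> simp [signX]

lemma sqrt_two_mul_self : √2 * √2 = (2 : ℝ) := Real.mul_self_sqrt (by norm_num)

lemma expectation_correlations (ρ : Matrix (α × β × ε) (α × β × ε) ℂ) (D : Devices α β ε)
    (x y : Fin 2) (e : Fin 4) :
    expectation (correlations ρ D) x y e =
      (opA β ε (D.obsA x) * opB α ε (D.obsB y) * opE α β (D.NE e) * ρ).trace.re := by
  simp only [expectation, correlations, born, ← opA_mul_opB_mul_opE, Devices.obsA, Devices.obsB,
    opA_sub, opB_sub, sub_mul, mul_sub, Matrix.trace_sub, Complex.sub_re]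
  ring

lemma functionalI_correlations (ρ : Matrix (α × β × ε) (α × β × ε) ℂ) (D : Devices α β ε) :
    functionalI (correlations ρ D) = ∑ e,
      ((signZ e • (opA β ε (D.obsA 0) * (opB α ε (D.obsB 0) - opB α ε (D.obsB 1))) +
        signX e • (opA β ε (D.obsA 1) * (opB α ε (D.obsB 0) + opB α ε (D.obsB 1)))) *
        opE α β (D.NE e) * ρ).trace.re := by
  simp only [functionalI, expectation_correlations, signZ, signX]
  refine Finset.sum_congr rfl fun e _ => ?_
  simp only [mul_sub, mul_add, add_mul, sub_mul, smul_mul_assoc, Matrix.trace_add,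
    Matrix.trace_smul, Matrix.trace_sub, Complex.add_re, Complex.sub_re, Complex.smul_re,
    smul_eq_mul]

/-- The defect operator `√2 A₀ - s_e (B₀ - B₁)`. -/
noncomputable def defectZ (D : Devices α β ε) (e : Fin 4) : Matrix (α × β × ε) (α × β × ε) ℂ :=
  √2 • opA β ε (D.obsA 0) - signZ e • (opB α ε (D.obsB 0) - opB α ε (D.obsB 1))

/-- The defect operator `√2 A₁ - t_e (B₀ + B₁)`. -/
noncomputable def defectX (D : Devices α β ε) (e : Fin 4) : Matrix (α × β × ε) (α × β × ε) ℂ :=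
  √2 • opA β ε (D.obsA 1) - signX e • (opB α ε (D.obsB 0) + opB α ε (D.obsB 1))

lemma obsA_isHermitian {D : Devices α β ε} (hD : D.IsValid) (x : Fin 2) :
    (D.obsA x).IsHermitian :=
  ((hD.1 x).1 0).isHermitian.sub ((hD.1 x).1 1).isHermitian

lemma obsB_isHermitian {D : Devices α β ε} (hD : D.IsValid) (x : Fin 2) :
    (D.obsB x).IsHermitian :=
  ((hD.2.1 x).1 0).isHermitian.sub ((hD.2.1 x).1 1).isHermitian

lemma defectZ_isHermitian {D : Devices α β ε} (hD : D.IsValid) (e : Fin 4) :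
    (defectZ D e).IsHermitian :=
  (isHermitian_real_smul _ (obsA_isHermitian hD 0).opA).sub
    (isHermitian_real_smul _ ((obsB_isHermitian hD 0).opB.sub (obsB_isHermitian hD 1).opB))

lemma defectX_isHermitian {D : Devices α β ε} (hD : D.IsValid) (e : Fin 4) :
    (defectX D e).IsHermitian :=
  (isHermitian_real_smul _ (obsA_isHermitian hD 1).opA).sub
    (isHermitian_real_smul _ ((obsB_isHermitian hD 0).opB.add (obsB_isHermitian hD 1).opB))

lemma re_trace_defectZ_nonneg {ρ : Matrix (α × β × ε) (α × β × ε) ℂ} (hρ : IsState ρ)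
    {D : Devices α β ε} (hD : D.IsValid) (e : Fin 4) :
    0 ≤ (defectZ D e * opE α β (D.NE e) * defectZ D e * ρ).trace.re :=
  re_trace_nonneg (by
    simpa [(defectZ_isHermitian hD e).eq] using
      (hD.2.2.1 e).opE.conjTranspose_mul_mul_same (defectZ D e)) hρ.1

lemma re_trace_defectX_nonneg {ρ : Matrix (α × β × ε) (α × β × ε) ℂ} (hρ : IsState ρ)
    {D : Devices α β ε} (hD : D.IsValid) (e : Fin 4) :
    0 ≤ (defectX D e * opE α β (D.NE e) * defectX D e * ρ).trace.re :=
  re_trace_nonneg (by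
    simpa [(defectX_isHermitian hD e).eq] using
      (hD.2.2.1 e).opE.conjTranspose_mul_mul_same (defectX D e)) hρ.1

lemma bound_decomposition {ρ : Matrix (α × β × ε) (α × β × ε) ℂ} (hρ : ρ.trace = 1)
    {D : Devices α β ε} (hD : D.IsValid) :
    ∑ e, ((defectZ D e * opE α β (D.NE e) * defectZ D e * ρ).trace.re +
        (defectX D e * opE α β (D.NE e) * defectX D e * ρ).trace.re) +
      2 * ((opA β ε (1 - D.obsA 0 * D.obsA 0) * ρ).trace.re +
        (opA β ε (1 - D.obsA 1 * D.obsA 1) * ρ).trace.re +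
        (opB α ε (1 - D.obsB 0 * D.obsB 0) * ρ).trace.re +
        (opB α ε (1 - D.obsB 1 * D.obsB 1) * ρ).trace.re) =
      8 - 2 * √2 * functionalI (correlations ρ D) := by
  -- Completeness of Eve's measurement removes her element from every term whose other factor is
  -- independent of `e`.
  have hsum (X : Matrix (α × β × ε) (α × β × ε) ℂ) :
      ∑ e, (X * opE α β (D.NE e) * ρ).trace.re = (X * ρ).trace.re := by
    rw [← Complex.re_sum, ← Matrix.trace_sum, ← Finset.sum_mul, ← Finset.mul_sum, ← opE_sum,
      hD.2.2.2, opE_one, mul_one]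
  have key (e : Fin 4) := congrArg (fun X => (X * ρ).trace.re)
    (sum_of_squares sqrt_two_mul_self (signZ_mul_self e) (signX_mul_self e)
      (commute_opA_opB (ε := ε) (D.obsA 0) (D.obsB 0)) (commute_opA_opB (D.obsA 0) (D.obsB 1))
      (commute_opA_opB (D.obsA 1) (D.obsB 0)) (commute_opA_opB (D.obsA 1) (D.obsB 1))
      (commute_opA_opE _ (D.NE e)) (commute_opA_opE _ _) (commute_opB_opE _ _)
      (commute_opB_opE _ _))
  simp only [add_mul _ _ ρ, sub_mul _ _ ρ, smul_mul_assoc _ _ ρ, Matrix.trace_add,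
    Matrix.trace_sub, Matrix.trace_smul, Complex.add_re, Complex.sub_re, Complex.smul_re,
    smul_eq_mul] at key
  have key' := Finset.sum_congr (s₁ := Finset.univ) rfl fun e (_ : e ∈ Finset.univ) => key e
  rw [Finset.sum_add_distrib, Finset.sum_sub_distrib, ← Finset.mul_sum, ← Finset.mul_sum,
    ← Finset.mul_sum, hsum, ← functionalI_correlations] at key'
  have h1 := hsum 1
  simp only [one_mul, hρ, Complex.one_re] at h1
  rw [h1] at key'
  simp only [defectZ, defectX, opA_sub, opB_sub, opA_one, opB_one, opA_mul, opB_mul]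
  simp only [add_mul, Matrix.trace_add, Complex.add_re] at key' ⊢
  linarith

theorem functionalI_le {ρ : Matrix (α × β × ε) (α × β × ε) ℂ} (hρ : IsState ρ)
    {D : Devices α β ε} (hD : D.IsValid) : functionalI (correlations ρ D) ≤ 2 * √2 := by
  have h := bound_decomposition hρ.2 hD
  have hZ := re_trace_defectZ_nonneg hρ hD
  have hX := re_trace_defectX_nonneg hρ hD
  have hs := Finset.sum_nonneg fun e (_ : e ∈ Finset.univ) => add_nonneg (hZ e) (hX e)
  have hA (x : Fin 2) := re_trace_nonneg
    (posSemidef_one_sub_observable_sq (hD.1 x)).opA hρ.1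
  have hB (x : Fin 2) := re_trace_nonneg
    (posSemidef_one_sub_observable_sq (hD.2.1 x)).opB hρ.1
  have hA0 := hA 0
  have hA1 := hA 1
  have hB0 := hB 0
  have hB1 := hB 1
  simp only [Devices.obsA, Devices.obsB] at h
  have h2 : 0 < √(2 : ℝ) := by positivity
  have := sqrt_two_mul_self
  nlinarith

end Bound

/-! ### Operator relations forced by the maximal value. -/

section Saturation
variable {α β ε : Type*} [Fintype α] [Fintype β] [Fintype ε]
  [DecidableEq α] [DecidableEq β] [DecidableEq ε]

lemma saturation {ρ : Matrix (α × β × ε) (α × β × ε) ℂ} (hρ : IsState ρ)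
    {D : Devices α β ε} (hD : D.IsValid) (hI : functionalI (correlations ρ D) = 2 * √2) :
    (∀ e, opE α β (D.NE e) * defectZ D e * ρ = 0) ∧
    (∀ e, opE α β (D.NE e) * defectX D e * ρ = 0) ∧
    (∀ x, opA β ε (1 - D.obsA x * D.obsA x) * ρ = 0) ∧
    (∀ y, opB α ε (1 - D.obsB y * D.obsB y) * ρ = 0) := by
  have h := bound_decomposition hρ.2 hD
  have hZ := re_trace_defectZ_nonneg hρ hD
  have hX := re_trace_defectX_nonneg hρ hD
  have hs := Finset.sum_nonneg fun e (_ : e ∈ Finset.univ) => add_nonneg (hZ e) (hX e)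
  have pA (x : Fin 2) : (opA β ε (1 - D.obsA x * D.obsA x)).PosSemidef :=
    (posSemidef_one_sub_observable_sq (hD.1 x)).opA
  have pB (x : Fin 2) : (opB α ε (1 - D.obsB x * D.obsB x)).PosSemidef :=
    (posSemidef_one_sub_observable_sq (hD.2.1 x)).opB
  have hA0 := re_trace_nonneg (pA 0) hρ.1
  have hA1 := re_trace_nonneg (pA 1) hρ.1
  have hB0 := re_trace_nonneg (pB 0) hρ.1
  have hB1 := re_trace_nonneg (pB 1) hρ.1
  -- The right side becomes 0, so each nonnegative summand is 0 separately.
  rw [hI, show 8 - 2 * √2 * (2 * √2) = 8 - 4 * (√2 * √2) by ring, sqrt_two_mul_self] at h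
  have h0 : ∑ e, ((defectZ D e * opE α β (D.NE e) * defectZ D e * ρ).trace.re +
        (defectX D e * opE α β (D.NE e) * defectX D e * ρ).trace.re) = 0 := by linarith
  rw [Finset.sum_eq_zero_iff_of_nonneg fun e _ => add_nonneg (hZ e) (hX e)] at h0
  refine ⟨fun e => ?_, fun e => ?_, fun x => ?_, fun y => ?_⟩
  · refine mul_mul_eq_zero_of_re_trace_eq_zero (hD.2.2.1 e).opE (defectZ_isHermitian hD e) hρ.1 ?_
    linarith [h0 e (Finset.mem_univ e), hZ e, hX e]
  · refine mul_mul_eq_zero_of_re_trace_eq_zero (hD.2.2.1 e).opE (defectX_isHermitian hD e) hρ.1 ?_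
    linarith [h0 e (Finset.mem_univ e), hZ e, hX e]
  · refine mul_eq_zero_of_re_trace_eq_zero (pA x) hρ.1 ?_
    fin_cases x <;> simp only [Fin.zero_eta, Fin.mk_one] <;> linarith
  · refine mul_eq_zero_of_re_trace_eq_zero (pB y) hρ.1 ?_
    fin_cases y <;> simp only [Fin.zero_eta, Fin.mk_one] <;> linarith

/-- Bob's effective observable `(B₀ - B₁)/√2`. -/
noncomputable def Devices.obsZ (D : Devices α β ε) : Matrix β β ℂ :=
  (√2)⁻¹ • (D.obsB 0 - D.obsB 1)

/-- Bob's effective observable `(B₀ + B₁)/√2`. -/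
noncomputable def Devices.obsX (D : Devices α β ε) : Matrix β β ℂ :=
  (√2)⁻¹ • (D.obsB 0 + D.obsB 1)

/-- Eve's parity observable paired with `A₀`. -/
noncomputable def Devices.parityZ (D : Devices α β ε) : Matrix ε ε ℂ := ∑ e, signZ e • D.NE e

/-- Eve's parity observable paired with `A₁`. -/
noncomputable def Devices.parityX (D : Devices α β ε) : Matrix ε ε ℂ := ∑ e, signX e • D.NE e

lemma isHermitian_sum_smul_povm {κ ι : Type*} [Fintype κ] [DecidableEq ι] {M : κ → Matrix ι ι ℂ}
    (hM : IsPOVM M) (s : κ → ℝ) : (∑ k, s k • M k).IsHermitian := by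
  rw [Matrix.IsHermitian, Matrix.conjTranspose_sum]
  exact Finset.sum_congr rfl fun k _ => isHermitian_real_smul _ (hM.1 k).isHermitian

section Ring
variable {R : Type*} [Ring R] [Algebra ℝ R]

lemma swap_relation {a z σ : R} {s : ℝ} (hs : s * s = 1) (h : a * σ = s • (z * σ)) :
    z * σ = s • (a * σ) := by
  rw [h, smul_smul, hs, one_smul]

lemma sq_relation {a z σ : R} {s : ℝ} (hs : s * s = 1) (haz : Commute a z) (ha : a * a = 1)
    (h : a * σ = s • (z * σ)) : z * z * σ = σ := by
  rw [mul_assoc, swap_relation hs h, mul_smul_comm, ← mul_assoc, ← haz.eq, mul_assoc,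
    ← mul_smul_comm, ← h, ← mul_assoc, ha, one_mul]

/-- Moving a₀ and a₁ through to `σ` turns each product into the product of z and x in reversed
order, with the common sign st. -/
lemma anticommutation_relation {a₀ a₁ z x σ : R} {s t : ℝ} (h0x : Commute a₀ x)
    (h1z : Commute a₁ z) (hzx : x * z + z * x = 0)
    (h0 : a₀ * σ = s • (z * σ)) (h1 : a₁ * σ = t • (x * σ)) :
    (a₀ * a₁ + a₁ * a₀) * σ = 0 := by
  rw [add_mul, mul_assoc, mul_assoc, h0, h1, mul_smul_comm, mul_smul_comm, ← mul_assoc,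
    ← mul_assoc, h0x.eq, h1z.eq, mul_assoc, mul_assoc, h0, h1, mul_smul_comm, mul_smul_comm,
    smul_smul, smul_smul, mul_comm t s, ← smul_add, ← mul_assoc, ← mul_assoc, ← add_mul, hzx,
    zero_mul, smul_zero]

end Ring

lemma eq_of_opE_mul_eq {ρ : Matrix (α × β × ε) (α × β × ε) ℂ} (hρ : (reducedE ρ).PosDef)
    {X Y : Matrix ε ε ℂ} (h : opE α β X * ρ = opE α β Y * ρ) : X = Y :=
  sub_eq_zero.mp <| eq_zero_of_opE_mul_eq_zero hρ <| by rw [opE_sub, sub_mul, h, sub_self]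

/-- A family of relations `a N_e ρ = s_e z N_e ρ` transfers `a z` to Eve's parity. -/
lemma parity_relation {ρ : Matrix (α × β × ε) (α × β × ε) ℂ} (hρ : (reducedE ρ).PosDef)
    {N : Fin 4 → Matrix ε ε ℂ} (hN : ∑ e, N e = 1) {s : Fin 4 → ℝ} (hs : ∀ e, s e * s e = 1)
    {a : Matrix α α ℂ} {z : Matrix β β ℂ} (hz : z * z = 1)
    (h : ∀ e, opA β ε a * (opE α β (N e) * ρ) = s e • (opB α ε z * (opE α β (N e) * ρ))) :
    opB α ε z * opA β ε a * ρ = opE α β (∑ e, s e • N e) * ρ ∧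
      (∀ e, N e * ∑ k, s k • N k = s e • N e) ∧
      (∑ k, s k • N k) * ∑ k, s k • N k = 1 := by
  have hz' : opB α ε z * opB α ε z = 1 := by rw [← opB_mul, hz, opB_one]
  have hσ (e : Fin 4) : opB α ε z * opA β ε a * (opE α β (N e) * ρ) =
      s e • (opE α β (N e) * ρ) := by
    rw [mul_assoc, h, mul_smul_comm, ← mul_assoc, hz', one_mul]
  have h1 : opB α ε z * opA β ε a * ρ = opE α β (∑ e, s e • N e) * ρ := by
    calc opB α ε z * opA β ε a * ρ
        = opB α ε z * opA β ε a * (opE α β (∑ e, N e) * ρ) := by rw [hN, opE_one, one_mul]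
      _ = _ := by
        rw [opE_sum, opE_sum, Finset.sum_mul, Finset.mul_sum, Finset.sum_mul]
        exact Finset.sum_congr rfl fun e _ => by rw [hσ, opE_smul, smul_mul_assoc]
  -- On ρ the signed sum acts as z a, which commutes with `N e` and equals the sign `s e` on N_e ρ;
  -- Eve's full rank then removes ρ.
  have h2 (e : Fin 4) : N e * ∑ k, s k • N k = s e • N e := by
    refine eq_of_opE_mul_eq hρ ?_
    rw [opE_mul, mul_assoc, ← h1, opE_smul, smul_mul_assoc, ← hσ, ← mul_assoc, ← mul_assoc,
      ← mul_assoc, ← (commute_opB_opE z (N e)).eq, mul_assoc (opB α ε z),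
      ← (commute_opA_opE a (N e)).eq]
    simp only [mul_assoc]
  refine ⟨h1, h2, ?_⟩
  rw [Finset.sum_mul, ← hN]
  exact Finset.sum_congr rfl fun e _ => by rw [smul_mul_assoc, h2, smul_smul, hs, one_smul]

/-- The algebraic relations that a maximal violation forces on the devices. -/
structure IdealRelations (ρ : Matrix (α × β × ε) (α × β × ε) ℂ) (D : Devices α β ε) : Prop where
  obsA_sq : ∀ x, D.obsA x * D.obsA x = 1
  obsZ_sq : D.obsZ * D.obsZ = 1
  obsX_sq : D.obsX * D.obsX = 1
  obsA_anticomm : D.obsA 0 * D.obsA 1 + D.obsA 1 * D.obsA 0 = 0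
  obsB_anticomm : D.obsZ * D.obsX + D.obsX * D.obsZ = 0
  parityZ_mul : opB α ε D.obsZ * opA β ε (D.obsA 0) * ρ = opE α β D.parityZ * ρ
  parityX_mul : opB α ε D.obsX * opA β ε (D.obsA 1) * ρ = opE α β D.parityX * ρ
  parityZ_sq : D.parityZ * D.parityZ = 1
  parityX_sq : D.parityX * D.parityX = 1
  eve : ∀ e, D.NE e =
    (4 : ℝ)⁻¹ • ((1 + signZ e • D.parityZ) * (1 + signX e • D.parityX))

/-- Multiply the right-hand product by 1 = Σ N_k on the left. Each N_k contributes the factor (1 +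
s_e s_k)(1 + t_e t_k), which is 4 for k = e and 0 otherwise, because the four sign pairs are
distinct. Commutation of F and G is not needed. -/
lemma povm_eq_of_parities {N : Fin 4 → Matrix ε ε ℂ} (hN : ∑ e, N e = 1) {F G : Matrix ε ε ℂ}
    (hF : ∀ e, N e * F = signZ e • N e) (hG : ∀ e, N e * G = signX e • N e) (e : Fin 4) :
    N e = (4 : ℝ)⁻¹ • ((1 + signZ e • F) * (1 + signX e • G)) := by
  have h (k : Fin 4) : N k * ((1 + signZ e • F) * (1 + signX e • G)) =
      ((1 + signZ e * signZ k) * (1 + signX e * signX k)) • N k := by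
    simp only [← mul_assoc, mul_add, mul_one, mul_smul_comm, hF, add_mul, hG, smul_mul_assoc]
    module
  have hone := Finset.sum_mul Finset.univ N ((1 + signZ e • F) * (1 + signX e • G))
  rw [hN, one_mul] at hone
  rw [hone]
  simp only [h, Fin.sum_univ_four]
  fin_cases e <;> simp [signZ, signX, smul_smul] <;> norm_num

theorem idealRelations_of_saturation {ρ : Matrix (α × β × ε) (α × β × ε) ℂ} (hρ : IsState ρ)
    (hfull : LocallyFullRank ρ) {D : Devices α β ε} (hD : D.IsValid)
    (hI : functionalI (correlations ρ D) = 2 * √2) : IdealRelations ρ D := by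
  obtain ⟨hZ, hX, hA, hB⟩ := saturation hρ hD hI
  have r0 : (√2 : ℝ) ≠ 0 := by positivity
  have A_sq (x : Fin 2) : D.obsA x * D.obsA x = 1 :=
    (sub_eq_zero.mp (eq_zero_of_opA_mul_eq_zero hfull.1 (hA x))).symm
  have B_sq (x : Fin 2) : D.obsB x * D.obsB x = 1 :=
    (sub_eq_zero.mp (eq_zero_of_opB_mul_eq_zero hfull.2.1 (hB x))).symm
  have hZ' (e : Fin 4) : opA β ε (D.obsA 0) * (opE α β (D.NE e) * ρ) =
      signZ e • (opB α ε D.obsZ * (opE α β (D.NE e) * ρ)) := by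
    have := hZ e
    rw [defectZ, ← opB_sub, show D.obsB 0 - D.obsB 1 = √2 • D.obsZ by
      rw [Devices.obsZ, smul_smul, mul_inv_cancel₀ r0, one_smul], opB_smul, smul_comm,
      ← smul_sub, mul_smul_comm, smul_mul_assoc, smul_eq_zero_iff_right r0, mul_sub, sub_mul,
      mul_smul_comm, ← (commute_opA_opE _ _).eq, ← (commute_opB_opE _ _).eq, smul_mul_assoc,
      sub_eq_zero, mul_assoc, mul_assoc] at this
    exact this
  have hX' (e : Fin 4) : opA β ε (D.obsA 1) * (opE α β (D.NE e) * ρ) =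
      signX e • (opB α ε D.obsX * (opE α β (D.NE e) * ρ)) := by
    have := hX e
    rw [defectX, ← opB_add, show D.obsB 0 + D.obsB 1 = √2 • D.obsX by
      rw [Devices.obsX, smul_smul, mul_inv_cancel₀ r0, one_smul], opB_smul, smul_comm,
      ← smul_sub, mul_smul_comm, smul_mul_assoc, smul_eq_zero_iff_right r0, mul_sub, sub_mul,
      mul_smul_comm, ← (commute_opA_opE _ _).eq, ← (commute_opB_opE _ _).eq, smul_mul_assoc,
      sub_eq_zero, mul_assoc, mul_assoc] at this
    exact this
  have hA_sq (x : Fin 2) : opA β ε (D.obsA x) * opA β ε (D.obsA x) = 1 := by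
    rw [← opA_mul, A_sq, opA_one]
  -- The saturation relations hold only branch by branch, with N_e ρ in place of ρ; summing over `e`
  -- recovers ρ.
  have eq_zero_of (T : Matrix (α × β × ε) (α × β × ε) ℂ)
      (h : ∀ e, T * (opE α β (D.NE e) * ρ) = 0) : T * ρ = 0 := by
    rw [← one_mul ρ, ← opE_one, ← hD.2.2.2, opE_sum, Finset.sum_mul, Finset.mul_sum]
    exact Finset.sum_eq_zero fun e _ => h e
  have Z_sq : D.obsZ * D.obsZ = 1 := by
    refine sub_eq_zero.mp (eq_zero_of_opB_mul_eq_zero hfull.2.1 (eq_zero_of _ fun e => ?_))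
    rw [opB_sub, opB_mul, opB_one, sub_mul,
      sq_relation (signZ_mul_self e) (commute_opA_opB _ _) (hA_sq 0) (hZ' e), one_mul, sub_self]
  have X_sq : D.obsX * D.obsX = 1 := by
    refine sub_eq_zero.mp (eq_zero_of_opB_mul_eq_zero hfull.2.1 (eq_zero_of _ fun e => ?_))
    rw [opB_sub, opB_mul, opB_one, sub_mul,
      sq_relation (signX_mul_self e) (commute_opA_opB _ _) (hA_sq 1) (hX' e), one_mul, sub_self]
  -- The anticommutator is B₀² − B₁², and both squares are 1.
  have B_anti : D.obsX * D.obsZ + D.obsZ * D.obsX = 0 := by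
    simp only [Devices.obsX, Devices.obsZ, smul_mul_assoc, mul_smul_comm, add_mul, sub_mul,
      mul_add, mul_sub, B_sq]
    module
  have A_anti : D.obsA 0 * D.obsA 1 + D.obsA 1 * D.obsA 0 = 0 := by
    have h : (opA β ε (D.obsA 0) * opA β ε (D.obsA 1) +
        opA β ε (D.obsA 1) * opA β ε (D.obsA 0)) * ρ = 0 := eq_zero_of _ fun e =>
      anticommutation_relation (commute_opA_opB _ _) (commute_opA_opB _ _)
        (by rw [← opB_mul, ← opB_mul, ← opB_add, B_anti]; simp [opB]) (hZ' e) (hX' e)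
    rw [← opA_mul, ← opA_mul, ← opA_add] at h
    exact eq_zero_of_opA_mul_eq_zero hfull.1 h
  obtain ⟨pZ, nZ, sqZ⟩ := parity_relation hfull.2.2 hD.2.2.2 signZ_mul_self Z_sq hZ'
  obtain ⟨pX, nX, sqX⟩ := parity_relation hfull.2.2 hD.2.2.2 signX_mul_self X_sq hX'
  exact ⟨A_sq, Z_sq, X_sq, A_anti, by rw [add_comm, B_anti], pZ, pX, sqZ, sqX,
    povm_eq_of_parities hD.2.2.2 nZ nX⟩

end Saturation

/-! ### Canonical form of anticommuting involutions and of a source that mirrors them. -/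

section Canonical
variable {ι κ : Type*} [Fintype ι] [DecidableEq ι] [Fintype κ] [DecidableEq κ]

lemma exists_isometry_onto_range {P : Matrix ι ι ℂ} (hP : P.IsHermitian) (hPP : P * P = P) :
    ∃ (m : ℕ) (J : Matrix ι (Fin m) ℂ), J * Jᴴ = P ∧ Jᴴ * J = 1 := by
  obtain ⟨Q, lam, hQ1, hQ2, hspec⟩ : ∃ (Q : Matrix ι ι ℂ) (lam : ι → ℝ), Qᴴ * Q = 1 ∧
      Q * Qᴴ = 1 ∧ P = Q * Matrix.diagonal (fun i => (lam i : ℂ)) * Qᴴ :=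
    ⟨_, hP.eigenvalues, Unitary.coe_star_mul_self hP.eigenvectorUnitary,
      Unitary.coe_mul_star_self hP.eigenvectorUnitary, hP.spectral_theorem⟩
  have hdiag : Matrix.diagonal (fun i => (lam i : ℂ)) = Qᴴ * P * Q := by
    rw [hspec, ← mul_assoc, ← mul_assoc, hQ1, one_mul, mul_assoc, hQ1, mul_one]
  have hev (i : ι) : lam i = 0 ∨ lam i = 1 := by
    have h : Matrix.diagonal (fun i => (lam i : ℂ)) * Matrix.diagonal (fun i => (lam i : ℂ)) =
        Matrix.diagonal (fun i => (lam i : ℂ)) := by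
      rw [hdiag]
      calc Qᴴ * P * Q * (Qᴴ * P * Q) = Qᴴ * P * (Q * Qᴴ) * P * Q := by simp only [mul_assoc]
        _ = Qᴴ * (P * P) * Q := by rw [hQ2, mul_one, mul_assoc Qᴴ]
        _ = _ := by rw [hPP]
    rw [Matrix.diagonal_mul_diagonal] at h
    have h' : lam i * lam i = lam i := by
      exact_mod_cast congrFun (Matrix.diagonal_injective h) i
    by_cases h0 : lam i = 0
    · exact .inl h0
    · exact .inr (mul_right_cancel₀ h0 (by rw [h', one_mul]))
  -- The isometry consists of the eigenvector columns with eigenvalue 1.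
  let f := (Fintype.equivFin {i // lam i = 1}).symm
  refine ⟨_, Q.submatrix id (fun k => (f k : ι)), ?_, ?_⟩
  · rw [hspec]
    ext i j
    rw [Matrix.mul_apply, Matrix.mul_apply]
    simp only [Matrix.mul_diagonal, Matrix.submatrix_apply, id, Matrix.conjTranspose_apply]
    rw [f.sum_comp (fun k : {i // lam i = 1} => Q i k * star (Q j k)),
      ← Finset.sum_subtype (Finset.univ.filter fun k => lam k = 1) (by simp)
        (fun k => Q i k * star (Q j k)), Finset.sum_filter]
    refine Finset.sum_congr rfl fun k _ => ?_
    rcases hev k with h | h <;> simp [h]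
  · rw [Matrix.conjTranspose_submatrix, ← Matrix.submatrix_mul _ _ _ _ _ Function.bijective_id, hQ1]
    ext k l
    simp [Matrix.one_apply, Subtype.val_inj]

/-- Two anticommuting involutions are `σ_z ⊗ 1` and `σ_x ⊗ 1` in a suitable basis. -/
theorem exists_pauli_form {T₀ T₁ : Matrix ι ι ℂ} (h₀ : T₀.IsHermitian) (h₁ : T₁.IsHermitian)
    (hsq₀ : T₀ * T₀ = 1) (hsq₁ : T₁ * T₁ = 1) (hanti : T₀ * T₁ + T₁ * T₀ = 0) :
    ∃ (m : ℕ) (U : Matrix (Fin 2 × Fin m) ι ℂ), IsUnitaryMap U ∧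
      U * T₀ * Uᴴ = σz ⊗ₖ (1 : Matrix (Fin m) (Fin m) ℂ) ∧
      U * T₁ * Uᴴ = σx ⊗ₖ (1 : Matrix (Fin m) (Fin m) ℂ) := by
  set P : Matrix ι ι ℂ := (2⁻¹ : ℝ) • (1 + T₀) with hPdef
  have hP : P.IsHermitian := by
    simp [Matrix.IsHermitian, hPdef, Matrix.conjTranspose_smul, h₀.eq]
  have hPP : P * P = P := by
    simp only [hPdef, smul_mul_assoc, mul_smul_comm, mul_add, add_mul, hsq₀, mul_one, one_mul]
    module
  obtain ⟨m, J, hJ, hJ1⟩ := exists_isometry_onto_range hP hPP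
  have hT10 : T₁ * T₀ = -(T₀ * T₁) := by rw [eq_neg_iff_add_eq_zero, add_comm, hanti]
  have hPJ : P * J = J := by rw [← hJ, Matrix.mul_assoc, hJ1, Matrix.mul_one]
  have hJP : Jᴴ * P = Jᴴ := by rw [← hJ, ← Matrix.mul_assoc, hJ1, Matrix.one_mul]
  have hT0J : T₀ * J = J := by
    have : T₀ * P = P := by
      simp only [hPdef, mul_smul_comm, mul_add, hsq₀, mul_one, add_comm]
    rw [← hPJ, ← Matrix.mul_assoc, this]
  -- `T₁` exchanges the two eigenspaces of `T₀`: it maps the range of `P` to the orthogonal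
  -- complement, and `T₁ * P * T₁` is the complementary projection.
  have hPTP : P * T₁ * P = 0 := by
    simp only [hPdef, smul_mul_assoc, mul_smul_comm, mul_add, add_mul, mul_one, one_mul,
      mul_assoc, hT10, mul_neg, ← mul_assoc T₀ T₀, hsq₀]
    module
  have hJTJ : Jᴴ * T₁ * J = 0 := by
    calc Jᴴ * T₁ * J = Jᴴ * P * T₁ * (P * J) := by rw [hPJ, hJP]
      _ = Jᴴ * (P * T₁ * P) * J := by simp only [Matrix.mul_assoc]
      _ = 0 := by rw [hPTP]; simp
  have hTPT : P + T₁ * P * T₁ = 1 := by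
    simp only [hPdef, smul_mul_assoc, mul_smul_comm, mul_add, add_mul, mul_one,
      hT10, neg_mul, mul_assoc, hsq₁]
    module
  -- Orthonormal frames of the +1 and −1 eigenspaces, matched by `T₁` so that it acts as a pure
  -- flip. `U` below is the adjoint of the two blocks side by side.
  let K : Fin 2 → Matrix ι (Fin m) ℂ := ![J, T₁ * J]
  have hK1 (i j : Fin 2) : (K i)ᴴ * K j = if i = j then 1 else 0 := by
    fin_cases i <;> fin_cases j
    · simpa [K] using hJ1
    · simpa [K, Matrix.mul_assoc] using hJTJ
    · simpa [K, h₁.eq, Matrix.conjTranspose_mul] using hJTJ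
    · simp only [K, h₁.eq, Matrix.conjTranspose_mul, Fin.mk_one, Matrix.cons_val_one,
        Matrix.cons_val_fin_one, if_true]
      rw [Matrix.mul_assoc, ← Matrix.mul_assoc T₁, hsq₁, Matrix.one_mul, hJ1]
  have hK2 : K 0 * (K 0)ᴴ + K 1 * (K 1)ᴴ = 1 := by
    simp only [K, Matrix.cons_val_zero, Matrix.cons_val_one, Matrix.cons_val_fin_one,
      Matrix.conjTranspose_mul, h₁.eq]
    rw [Matrix.mul_assoc T₁, ← Matrix.mul_assoc J, hJ, ← Matrix.mul_assoc, hTPT]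
  have hT0K (j : Fin 2) : T₀ * K j = (if j = 0 then 1 else -1 : ℂ) • K j := by
    fin_cases j
    · simpa [K] using hT0J
    · have : T₀ * T₁ = -(T₁ * T₀) := by rw [hT10, neg_neg]
      simp [K, ← Matrix.mul_assoc, this]
      rw [Matrix.mul_assoc, hT0J]
  have hT1K (j : Fin 2) : T₁ * K j = K (1 - j) := by
    fin_cases j
    · simp [K]
    · simp [K, ← Matrix.mul_assoc, hsq₁]
  let U : Matrix (Fin 2 × Fin m) ι ℂ := Matrix.of fun p a => star (K p.1 a p.2)
  have hU (T : Matrix ι ι ℂ) (i j : Fin 2) (k l : Fin m) :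
      (U * T * Uᴴ) (i, k) (j, l) = ((K i)ᴴ * (T * K j)) k l := by
    rw [← Matrix.mul_assoc]
    simp [Matrix.mul_apply, U]
  have hone := hU 1
  refine ⟨m, U, ⟨?_, ?_⟩, ?_, ?_⟩
  · ext ⟨i, k⟩ ⟨j, l⟩
    have := hone i j k l
    rw [Matrix.mul_one, Matrix.one_mul, hK1] at this
    rw [this]
    by_cases h : i = j <;> simp [h, Matrix.one_apply]
  · rw [← hK2]
    ext a b
    simp [Matrix.mul_apply, U, Fintype.sum_prod_type, Fin.sum_univ_two]
  · ext ⟨i, k⟩ ⟨j, l⟩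
    rw [hU, hT0K, Matrix.mul_smul, hK1]
    fin_cases i <;> fin_cases j <;> simp [σz, Matrix.one_apply]
  · ext ⟨i, k⟩ ⟨j, l⟩
    rw [hU, hT1K, hK1]
    fin_cases i <;> fin_cases j <;> simp [σx, Matrix.one_apply]

/-- A form of Schur's lemma: intertwining σz kills the off-diagonal blocks, and intertwining σx
makes the two diagonal blocks equal. -/
lemma exists_one_kronecker_of_commute {m n : ℕ} {G : Matrix (Fin 2 × Fin m) (Fin 2 × Fin n) ℂ}
    (hz : (σz ⊗ₖ (1 : Matrix (Fin m) (Fin m) ℂ)) * G =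
      G * (σz ⊗ₖ (1 : Matrix (Fin n) (Fin n) ℂ)))
    (hx : (σx ⊗ₖ (1 : Matrix (Fin m) (Fin m) ℂ)) * G =
      G * (σx ⊗ₖ (1 : Matrix (Fin n) (Fin n) ℂ))) :
    ∃ S : Matrix (Fin m) (Fin n) ℂ, G = (1 : Matrix (Fin 2) (Fin 2) ℂ) ⊗ₖ S := by
  refine ⟨Matrix.of fun k l => G (0, k) (0, l), ?_⟩
  have ez (i j k l) := congrFun (congrFun hz (i, k)) (j, l)
  have ex (i j k l) := congrFun (congrFun hx (i, k)) (j, l)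
  simp only [Matrix.mul_apply, Fintype.sum_prod_type, Fin.sum_univ_two, Matrix.kroneckerMap_apply,
    Matrix.one_apply, mul_ite, ite_mul, mul_one, mul_zero, zero_mul, Finset.sum_ite_eq,
    Finset.sum_ite_eq', Finset.mem_univ, if_true, σz, σx] at ez ex
  ext ⟨i, k⟩ ⟨j, l⟩
  have e01 := ez 0 1 k l
  have e10 := ez 1 0 k l
  have e00 := ex 0 1 k l
  simp at e01 e10 e00
  fin_cases i <;> fin_cases j
  · simp
  · simp
    linear_combination (1 / 2 : ℂ) * e01
  · simp
    linear_combination (-1 / 2 : ℂ) * e10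
  · simp
    linear_combination e00

/-- A source whose local states are invertible and commute with two anticommuting involutions of
one side is a qubit singlet state times junk, and the involutions are mirrored on the other
side. -/
theorem exists_source_form {X : Matrix ι κ ℂ} (hl : IsUnit (Xᴴ * X)) (hr : IsUnit (X * Xᴴ))
    {T₀ T₁ : Matrix ι ι ℂ} (h₀ : T₀.IsHermitian) (h₁ : T₁.IsHermitian)
    (hsq₀ : T₀ * T₀ = 1) (hsq₁ : T₁ * T₁ = 1) (hanti : T₀ * T₁ + T₁ * T₀ = 0)
    (hc₀ : Commute T₀ (X * Xᴴ)) (hc₁ : Commute T₁ (X * Xᴴ)) :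
    ∃ (m n : ℕ) (U : Matrix (Fin 2 × Fin m) ι ℂ) (Q : Matrix (Fin 2 × Fin n) κ ℂ)
      (S : Matrix (Fin m) (Fin n) ℂ), IsUnitaryMap U ∧ IsUnitaryMap Q ∧
      U * T₀ * Uᴴ = σz ⊗ₖ (1 : Matrix (Fin m) (Fin m) ℂ) ∧
      U * T₁ * Uᴴ = σx ⊗ₖ (1 : Matrix (Fin m) (Fin m) ℂ) ∧
      U * X * Qᴴ = (1 : Matrix (Fin 2) (Fin 2) ℂ) ⊗ₖ S ∧
      T₀ * X = X * (Qᴴ * (σz ⊗ₖ (1 : Matrix (Fin n) (Fin n) ℂ)) * Q) ∧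
      T₁ * X = X * (Qᴴ * (σx ⊗ₖ (1 : Matrix (Fin n) (Fin n) ℂ)) * Q) := by
  obtain ⟨u, hu⟩ := hl
  -- A two-sided inverse of `X`: `hl` gives the left inverse, and `hr` makes it a right inverse even
  -- though the index types differ.
  let L : Matrix κ ι ℂ := (↑u⁻¹ : Matrix κ κ ℂ) * Xᴴ
  have hLX : L * X = 1 := by
    rw [Matrix.mul_assoc, ← hu, Units.inv_mul]
  have hXL : X * L = 1 := by
    refine hr.mul_left_inj.mp ?_
    rw [Matrix.one_mul, Matrix.mul_assoc, ← Matrix.mul_assoc L, hLX, Matrix.one_mul]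
  have hXL' : Xᴴ * Lᴴ = 1 := by rw [← Matrix.conjTranspose_mul, hLX, Matrix.conjTranspose_one]
  -- The similarity T ↦ X⁻¹TX preserves algebraic relations but not Hermiticity in general;
  -- commuting with XX† is what restores it.
  have herm {T : Matrix ι ι ℂ} (hT : T.IsHermitian) (hc : Commute T (X * Xᴴ)) :
      (L * T * X).IsHermitian := by
    rw [Matrix.IsHermitian, Matrix.conjTranspose_mul, Matrix.conjTranspose_mul, hT.eq]
    calc Xᴴ * (T * Lᴴ) = (L * X) * Xᴴ * (T * Lᴴ) := by rw [hLX, Matrix.one_mul]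
      _ = L * (X * Xᴴ * T) * Lᴴ := by simp only [Matrix.mul_assoc]
      _ = L * (T * (X * Xᴴ)) * Lᴴ := by rw [hc.eq]
      _ = L * T * X * (Xᴴ * Lᴴ) := by simp only [Matrix.mul_assoc]
      _ = L * T * X := by rw [hXL', Matrix.mul_one]
  have hmul (T T' : Matrix ι ι ℂ) : L * T * X * (L * T' * X) = L * (T * T') * X := by
    calc _ = L * T * (X * L) * T' * X := by simp only [Matrix.mul_assoc]
      _ = _ := by rw [hXL, Matrix.mul_one, Matrix.mul_assoc L]
  have hint (T : Matrix ι ι ℂ) : T * X = X * (L * T * X) := by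
    rw [Matrix.mul_assoc, ← Matrix.mul_assoc, hXL, Matrix.one_mul]
  obtain ⟨m, U, hU, hU₀, hU₁⟩ := exists_pauli_form h₀ h₁ hsq₀ hsq₁ hanti
  obtain ⟨n, Q, hQ, hQ₀, hQ₁⟩ := exists_pauli_form (herm h₀ hc₀) (herm h₁ hc₁)
    (by rw [hmul, hsq₀, Matrix.mul_one, hLX]) (by rw [hmul, hsq₁, Matrix.mul_one, hLX])
    (by rw [hmul, hmul, ← Matrix.add_mul, ← Matrix.mul_add, hanti]; simp)
  have hcomm {T : Matrix ι ι ℂ} {σ : Matrix (Fin 2) (Fin 2) ℂ}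
      (e : U * T * Uᴴ = σ ⊗ₖ (1 : Matrix (Fin m) (Fin m) ℂ))
      (e' : Q * (L * T * X) * Qᴴ = σ ⊗ₖ (1 : Matrix (Fin n) (Fin n) ℂ)) :
      (σ ⊗ₖ (1 : Matrix (Fin m) (Fin m) ℂ)) * (U * X * Qᴴ) =
        (U * X * Qᴴ) * (σ ⊗ₖ (1 : Matrix (Fin n) (Fin n) ℂ)) := by
    rw [← e, ← e']
    calc U * T * Uᴴ * (U * X * Qᴴ) = U * T * (Uᴴ * U) * X * Qᴴ := by simp only [Matrix.mul_assoc]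
      _ = U * (T * X) * Qᴴ := by rw [hU.2, Matrix.mul_one, Matrix.mul_assoc U]
      _ = U * X * (1 : Matrix κ κ ℂ) * (L * T * X) * Qᴴ := by
        rw [hint, Matrix.mul_one, ← Matrix.mul_assoc U]
      _ = _ := by rw [← hQ.2]; simp only [Matrix.mul_assoc]
  have hback {T : Matrix ι ι ℂ} {σ : Matrix (Fin 2) (Fin 2) ℂ}
      (e' : Q * (L * T * X) * Qᴴ = σ ⊗ₖ (1 : Matrix (Fin n) (Fin n) ℂ)) :
      T * X = X * (Qᴴ * (σ ⊗ₖ (1 : Matrix (Fin n) (Fin n) ℂ)) * Q) := by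
    rw [← e', hint]
    congr 1
    calc L * T * X = (Qᴴ * Q) * (L * T * X) * (Qᴴ * Q) := by
          rw [hQ.2, Matrix.one_mul, Matrix.mul_one]
      _ = _ := by simp only [Matrix.mul_assoc]
  obtain ⟨S, hS⟩ := exists_one_kronecker_of_commute (hcomm hU₀ hQ₀) (hcomm hU₁ hQ₁)
  exact ⟨m, n, U, Q, S, hU, hQ, hU₀, hU₁, hS, hback hQ₀, hback hQ₁⟩

end Canonical

/-! ### Vectors as coefficient matrices, and operational independence as a product state. -/

section StateMatrix
variable {α β ε αb βb : Type*} [Fintype α] [Fintype β] [Fintype ε] [Fintype αb] [Fintype βb]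
  [DecidableEq α] [DecidableEq β] [DecidableEq ε] [DecidableEq αb] [DecidableEq βb]

/-- The coefficient matrix of a bipartite vector. -/
def sourceMatrix (χ : α × αb → ℂ) : Matrix α αb ℂ := Matrix.of fun a k => χ (a, k)

/-- The coefficient matrix of a tripartite vector, across the cut `A B | E`. -/
def stateMatrix (ψ : α × β × ε → ℂ) : Matrix (α × β) ε ℂ :=
  Matrix.of fun p e => ψ (p.1, p.2, e)

lemma stateMatrix_injective :
    Function.Injective (stateMatrix : (α × β × ε → ℂ) → Matrix (α × β) ε ℂ) := by
  intro ψ φ h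
  ext ⟨a, b, e⟩
  exact congrFun (congrFun h (a, b)) e

/-- Eve's operators act from the right and transposed, which is the source of all transposes and
entrywise conjugates in what follows. -/
lemma stateMatrix_mulVec (X : Matrix α α ℂ) (Y : Matrix β β ℂ) (Z : Matrix αb ε ℂ)
    (ψ : α × β × ε → ℂ) :
    stateMatrix ((X ⊗ₖ (Y ⊗ₖ Z)) *ᵥ ψ) = (X ⊗ₖ Y) * stateMatrix ψ * Zᵀ := by
  ext ⟨a, b⟩ e
  simp only [stateMatrix, Matrix.of_apply, Matrix.mulVec, dotProduct, Matrix.mul_apply,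
    Fintype.sum_prod_type, Matrix.kroneckerMap_apply, Matrix.transpose_apply, Finset.sum_mul]
  refine (Finset.sum_congr rfl fun a' _ => Finset.sum_comm).trans (Finset.sum_comm.trans ?_)
  refine Finset.sum_congr rfl fun e' _ => Finset.sum_congr rfl fun a' _ =>
    Finset.sum_congr rfl fun b' _ => ?_
  ring

lemma stateMatrix_sourcesVec (χA : α × αb → ℂ) (χB : β × βb → ℂ) :
    stateMatrix (sourcesVec χA χB) = sourceMatrix χA ⊗ₖ sourceMatrix χB := rfl

lemma trace_mul_conjTranspose_self {ι κ : Type*} [Fintype ι] [Fintype κ] (X : Matrix ι κ ℂ) :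
    (X * Xᴴ).trace = ((∑ i, ∑ k, ‖X i k‖ ^ 2 : ℝ) : ℂ) := by
  simp [Matrix.trace, Matrix.mul_apply, Complex.mul_conj, Complex.normSq_eq_norm_sq]

lemma isUnitVec_iff_sourceMatrix {χ : α × αb → ℂ} :
    IsUnitVec χ ↔ (sourceMatrix χ * (sourceMatrix χ)ᴴ).trace = 1 := by
  rw [trace_mul_conjTranspose_self, IsUnitVec, Fintype.sum_prod_type]
  norm_cast

lemma isUnitVec_iff_stateMatrix {ψ : α × β × ε → ℂ} :
    IsUnitVec ψ ↔ (stateMatrix ψ * (stateMatrix ψ)ᴴ).trace = 1 := by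
  rw [trace_mul_conjTranspose_self, IsUnitVec, Fintype.sum_prod_type, Fintype.sum_prod_type]
  simp only [Fintype.sum_prod_type]
  norm_cast

lemma isState_ketbra {ι : Type*} [Fintype ι] {ψ : ι → ℂ} (hψ : IsUnitVec ψ) :
    IsState (ketbra ψ) := by
  refine ⟨Matrix.posSemidef_vecMulVec_self_star ψ, ?_⟩
  rw [ketbra, Matrix.trace_vecMulVec]
  have : (∑ k, ((‖ψ k‖ ^ 2 : ℝ) : ℂ)) = 1 := by exact_mod_cast hψ
  simpa [dotProduct, Complex.mul_conj, Complex.normSq_eq_norm_sq] using this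

lemma mulVec_eq_of_mul_ketbra_eq {ι : Type*} [Fintype ι] {ψ : ι → ℂ} (hψ : IsUnitVec ψ)
    {X Y : Matrix ι ι ℂ} (h : X * ketbra ψ = Y * ketbra ψ) : X *ᵥ ψ = Y *ᵥ ψ := by
  have h1 : star ψ ⬝ᵥ ψ = 1 := by
    have := (isState_ketbra hψ).2
    rwa [ketbra, Matrix.trace_vecMulVec, dotProduct_comm] at this
  have h2 := congrArg (fun M => M *ᵥ ψ) h
  simpa [ketbra, ← Matrix.mulVec_mulVec, Matrix.vecMulVec_mulVec, h1] using h2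

lemma born_ketbra (ψ : α × β × ε → ℂ) (X : Matrix α α ℂ) (Y : Matrix β β ℂ) (Z : Matrix ε ε ℂ) :
    born (ketbra ψ) X Y Z =
      ((X ⊗ₖ Y) * stateMatrix ψ * Zᵀ * (stateMatrix ψ)ᴴ).trace.re := by
  rw [born, ketbra, Matrix.mul_vecMulVec, Matrix.trace_vecMulVec, ← stateMatrix_mulVec]
  congr 1
  simp [dotProduct, Matrix.trace, Matrix.mul_apply, stateMatrix, Fintype.sum_prod_type]

lemma reducedA_ketbra (ψ : α × β × ε → ℂ) (a a' : α) :
    reducedA (ketbra ψ) a a' = ∑ b, (stateMatrix ψ * (stateMatrix ψ)ᴴ) (a, b) (a', b) := by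
  simp [reducedA, ketbra, Matrix.vecMulVec_apply, Matrix.mul_apply, stateMatrix]

lemma reducedB_ketbra (ψ : α × β × ε → ℂ) (b b' : β) :
    reducedB (ketbra ψ) b b' = ∑ a, (stateMatrix ψ * (stateMatrix ψ)ᴴ) (a, b) (a, b') := by
  simp [reducedB, ketbra, Matrix.vecMulVec_apply, Matrix.mul_apply, stateMatrix]

lemma reducedE_ketbra (ψ : α × β × ε → ℂ) :
    reducedE (ketbra ψ) = ((stateMatrix ψ)ᴴ * stateMatrix ψ)ᵀ := by
  ext e e'
  simp [reducedE, ketbra, Matrix.vecMulVec_apply, Matrix.mul_apply, stateMatrix,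
    Fintype.sum_prod_type, mul_comm]

lemma trace_kronecker_one_mul_reducedA (ψ : α × β × ε → ℂ) (X : Matrix α α ℂ) :
    ((X ⊗ₖ (1 : Matrix β β ℂ)) * (stateMatrix ψ * (stateMatrix ψ)ᴴ)).trace =
      (X * reducedA (ketbra ψ)).trace := by
  simp only [Matrix.trace, Matrix.diag_apply, Matrix.mul_apply (M := X), reducedA_ketbra]
  generalize stateMatrix ψ * (stateMatrix ψ)ᴴ = G
  simp only [Matrix.mul_apply, Fintype.sum_prod_type, Matrix.kroneckerMap_apply,
    Matrix.one_apply, mul_ite, mul_one, mul_zero, ite_mul, zero_mul, Finset.sum_ite_eq,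
    Finset.mem_univ, if_true, Finset.mul_sum]
  exact Finset.sum_congr rfl fun a _ => Finset.sum_comm

lemma trace_one_kronecker_mul_reducedB (ψ : α × β × ε → ℂ) (Y : Matrix β β ℂ) :
    (((1 : Matrix α α ℂ) ⊗ₖ Y) * (stateMatrix ψ * (stateMatrix ψ)ᴴ)).trace =
      (Y * reducedB (ketbra ψ)).trace := by
  simp only [Matrix.trace, Matrix.diag_apply, Matrix.mul_apply (M := Y), reducedB_ketbra]
  generalize stateMatrix ψ * (stateMatrix ψ)ᴴ = G
  simp only [Matrix.mul_apply, Fintype.sum_prod_type, Matrix.kroneckerMap_apply,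
    Matrix.one_apply, ite_mul, zero_mul, one_mul, Finset.sum_ite_eq,
    Finset.sum_ite_irrel, Finset.sum_const_zero, Finset.mem_univ, if_true, Finset.mul_sum]
  rw [Finset.sum_comm]
  exact Finset.sum_congr rfl fun a _ => Finset.sum_comm

lemma born_ketbra_one (ψ : α × β × ε → ℂ) (X : Matrix α α ℂ) (Y : Matrix β β ℂ) :
    born (ketbra ψ) X Y 1 = ((X ⊗ₖ Y) * (stateMatrix ψ * (stateMatrix ψ)ᴴ)).trace.re := by
  rw [born_ketbra, Matrix.transpose_one, Matrix.mul_one, Matrix.mul_assoc]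

/-- Needed because `born` records only a real part: for Hermitian operators nothing is lost. -/
lemma trace_mul_im_eq_zero {ι : Type*} [Fintype ι] {X Y : Matrix ι ι ℂ} (hX : X.IsHermitian)
    (hY : Y.IsHermitian) : (X * Y).trace.im = 0 := by
  have h : star (X * Y).trace = (X * Y).trace := by
    rw [← Matrix.trace_conjTranspose, Matrix.conjTranspose_mul, hX.eq, hY.eq,
      Matrix.trace_mul_comm]
  exact Complex.conj_eq_iff_im.mp h

/-- Operational independence holds as soon as `ρ_AB = ρ_A ⊗ ρ_B`. -/
lemma operationallyIndependent_of_product {ψ : α × β × ε → ℂ}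
    {R : Matrix α α ℂ} {S : Matrix β β ℂ} (hR : R.IsHermitian)
    (hR1 : R.trace = 1) (hS1 : S.trace = 1)
    (h : stateMatrix ψ * (stateMatrix ψ)ᴴ = R ⊗ₖ S) : OperationallyIndependent (ketbra ψ) := by
  intro m n M N hM hN a b
  simp only [born_ketbra_one, h, ← Matrix.mul_kronecker_mul, Matrix.trace_kronecker,
    hR1, hS1, mul_one, one_mul]
  rw [Complex.mul_re, trace_mul_im_eq_zero (hM.1 a).isHermitian hR]
  ring

lemma isPOVM_projection {ι : Type*} [Fintype ι] [DecidableEq ι] {P : Matrix ι ι ℂ}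
    (hP : P.IsHermitian) (hPP : P * P = P) : IsPOVM ![P, 1 - P] := by
  have key {Q : Matrix ι ι ℂ} (hQ : Q.IsHermitian) (hQQ : Q * Q = Q) : Q.PosSemidef := by
    have := Matrix.posSemidef_conjTranspose_mul_self Q
    rwa [hQ.eq, hQQ] at this
  constructor
  · intro k
    fin_cases k
    · exact key hP hPP
    · refine key (Q := 1 - P) (Matrix.isHermitian_one.sub hP) ?_
      rw [mul_sub, mul_one, sub_mul, one_mul, hPP]
      abel
  · simp

/-- Complex polarization: no Hermiticity is needed. -/
lemma eq_zero_of_quadratic_form {ι : Type*} [Fintype ι] [DecidableEq ι] {T : Matrix ι ι ℂ}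
    (h : ∀ v : ι → ℂ, (ketbra v * T).trace = 0) : T = 0 := by
  have h' (v : ι → ℂ) : star v ⬝ᵥ (T *ᵥ v) = 0 := by
    rw [← h v, Matrix.trace_mul_comm, ketbra, Matrix.mul_vecMulVec, Matrix.trace_vecMulVec,
      dotProduct_comm]
  have h0 : Matrix.toEuclideanLin T = 0 := by
    refine (inner_map_self_eq_zero _).mp fun v => ?_
    have := congrArg star (h' v.ofLp)
    rw [← inner_conj_symm, EuclideanSpace.inner_eq_star_dotProduct]
    rw [star_zero] at this
    rw [dotProduct_comm]
    exact this
  simpa using h0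

lemma ketbra_isHermitian {ι : Type*} [Fintype ι] (v : ι → ℂ) : (ketbra v).IsHermitian :=
  (Matrix.posSemidef_vecMulVec_self_star v).isHermitian

/-- Every `|v⟩⟨v|` is a real multiple of a Hermitian projection. -/
lemma exists_projection {ι : Type*} [Fintype ι] (v : ι → ℂ) :
    ∃ (r : ℝ) (P : Matrix ι ι ℂ), P.IsHermitian ∧ P * P = P ∧ ketbra v = r • P := by
  set n : ℝ := ∑ k, ‖v k‖ ^ 2 with hn
  have hv : star v ⬝ᵥ v = (n : ℂ) := by
    simp [dotProduct, hn, Complex.conj_mul']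
  have hsq : ketbra v * ketbra v = n • ketbra v := by
    rw [ketbra, Matrix.vecMulVec_mul_vecMulVec, hv]
    ext i j
    simp [Matrix.vecMulVec_apply, mul_left_comm]
  by_cases h0 : n = 0
  · refine ⟨0, 0, Matrix.isHermitian_zero, by simp, ?_⟩
    have : v = 0 := by
      ext k
      have := (Finset.sum_eq_zero_iff_of_nonneg (by intros; positivity)).mp (hn.symm.trans h0) k
        (Finset.mem_univ k)
      simpa using this
    ext i j
    simp [this, ketbra, Matrix.vecMulVec_apply]
  · refine ⟨n, n⁻¹ • ketbra v, isHermitian_real_smul _ (ketbra_isHermitian v), ?_, ?_⟩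
    · rw [smul_mul_assoc, mul_smul_comm, hsq, smul_smul _ n, inv_mul_cancel₀ h0, one_smul]
    · rw [smul_smul, mul_inv_cancel₀ h0, one_smul]

/-- A matrix is determined by its expectations in product vectors. -/
lemma eq_zero_of_product_forms {T : Matrix (α × β) (α × β) ℂ}
    (h : ∀ v w, ((ketbra v ⊗ₖ ketbra w) * T).trace = 0) : T = 0 := by
  -- Polarization is applied on one factor at a time: first in `v` with Bob's operator fixed, then
  -- in `w` to each block.
  have h1 (Y : Matrix β β ℂ) (hY : ∀ v, ((ketbra v ⊗ₖ Y) * T).trace = 0) (a a' : α) :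
      (Y * Matrix.of fun b b' => T (a, b) (a', b')).trace = 0 := by
    have h0 : (Matrix.of fun a a' => (Y * Matrix.of fun b b' => T (a, b) (a', b')).trace) = 0 := by
      refine eq_zero_of_quadratic_form fun v => ?_
      rw [← hY v]
      simp only [Matrix.trace, Matrix.diag_apply, Matrix.mul_apply, Matrix.of_apply,
        Fintype.sum_prod_type, Matrix.kroneckerMap_apply, Finset.mul_sum, mul_assoc]
      refine Finset.sum_congr rfl fun a _ => ?_
      rw [Finset.sum_comm]
    exact congrFun (congrFun h0 a) a'
  ext ⟨a, b⟩ ⟨a', b'⟩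
  have h2 := eq_zero_of_quadratic_form (T := Matrix.of fun b b' => T (a, b) (a', b'))
    fun w => h1 (ketbra w) (fun v => h v w) a a'
  exact congrFun (congrFun h2 b) b'

/-- Two-outcome projective measurements suffice: rank-one operators on each side are multiples of
projections, and their products separate matrices. -/
theorem product_of_operationallyIndependent {ψ : α × β × ε → ℂ}
    (hA : (reducedA (ketbra ψ)).IsHermitian) (hB : (reducedB (ketbra ψ)).IsHermitian)
    (h : OperationallyIndependent (ketbra ψ)) :
    stateMatrix ψ * (stateMatrix ψ)ᴴ = reducedA (ketbra ψ) ⊗ₖ reducedB (ketbra ψ) := by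
  refine sub_eq_zero.mp (eq_zero_of_product_forms fun v w => ?_)
  obtain ⟨r, P, hP, hPP, hv⟩ := exists_projection v
  obtain ⟨s, Q, hQ, hQQ, hw⟩ := exists_projection w
  have key := h 2 2 _ _ (isPOVM_projection hP hPP) (isPOVM_projection hQ hQQ) 0 0
  simp only [Matrix.cons_val_zero, born_ketbra_one, trace_kronecker_one_mul_reducedA,
    trace_one_kronecker_mul_reducedB] at key
  have hPA := trace_mul_im_eq_zero hP hA
  have hPQ : (P ⊗ₖ Q).IsHermitian := by
    rw [Matrix.IsHermitian, Matrix.conjTranspose_kronecker, hP.eq, hQ.eq]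
  have h0 : ((P ⊗ₖ Q) * (stateMatrix ψ * (stateMatrix ψ)ᴴ -
      reducedA (ketbra ψ) ⊗ₖ reducedB (ketbra ψ))).trace = 0 := by
    apply Complex.ext
    · rw [Matrix.mul_sub, Matrix.trace_sub, Complex.sub_re, key, ← Matrix.mul_kronecker_mul,
        Matrix.trace_kronecker, Complex.mul_re, hPA]
      simp
    · refine trace_mul_im_eq_zero hPQ ((Matrix.isHermitian_mul_conjTranspose_self _).sub ?_)
      rw [Matrix.IsHermitian, Matrix.conjTranspose_kronecker, hA.eq, hB.eq]
  rw [hv, hw, Matrix.smul_kronecker, Matrix.kronecker_smul, smul_mul_assoc, smul_mul_assoc,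
    Matrix.trace_smul, Matrix.trace_smul, h0, smul_zero, smul_zero]

end StateMatrix

/-! ### Splitting Eve's system by uniqueness of purification. -/

section Splitting
variable {α β ε αb βb : Type*} [Fintype α] [Fintype β] [Fintype ε] [Fintype αb] [Fintype βb]
  [DecidableEq α] [DecidableEq β] [DecidableEq ε] [DecidableEq αb] [DecidableEq βb]

lemma conjTranspose_transpose_conjTranspose {ι κ : Type*} (M : Matrix ι κ ℂ) : Mᴴᵀᴴ = Mᵀ := by
  ext; simp

lemma isUnit_stateMatrix_gram {ψ : α × β × ε → ℂ} (hE : (reducedE (ketbra ψ)).PosDef) :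
    IsUnit ((stateMatrix ψ)ᴴ * stateMatrix ψ) := by
  rw [reducedE_ketbra] at hE
  have := hE.isUnit
  rwa [Matrix.isUnit_iff_isUnit_det, Matrix.det_transpose, ← Matrix.isUnit_iff_isUnit_det] at this

/-- Two purifications of the same state, the first of full rank on the purifying side, are related
by a unitary. -/
lemma exists_unitary_of_mul_conjTranspose_eq {ι : Type*} [Fintype ι] [DecidableEq ι]
    {M : Matrix ι ε ℂ} {K : Matrix ι ι ℂ} (hM : IsUnit (Mᴴ * M)) (hK : IsUnit K)
    (h : M * Mᴴ = K * Kᴴ) : ∃ W : Matrix ι ε ℂ, W * Wᴴ = 1 ∧ Wᴴ * W = 1 ∧ M = K * W := by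
  obtain ⟨u, rfl⟩ := hK
  let W : Matrix ι ε ℂ := (↑u⁻¹ : Matrix ι ι ℂ) * M
  have hW : M = (u : Matrix ι ι ℂ) * W := by
    rw [← Matrix.mul_assoc, Units.mul_inv, Matrix.one_mul]
  have h1 : W * Wᴴ = 1 := by
    have e : (u : Matrix ι ι ℂ)ᴴ * (↑u⁻¹ : Matrix ι ι ℂ)ᴴ = 1 := by
      rw [← Matrix.conjTranspose_mul, Units.inv_mul, Matrix.conjTranspose_one]
    calc W * Wᴴ = (↑u⁻¹ : Matrix ι ι ℂ) * (M * Mᴴ) * (↑u⁻¹ : Matrix ι ι ℂ)ᴴ := by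
          simp only [W, Matrix.conjTranspose_mul, Matrix.mul_assoc]
      _ = (↑u⁻¹ * ↑u : Matrix ι ι ℂ) * ((u : Matrix ι ι ℂ)ᴴ * (↑u⁻¹ : Matrix ι ι ℂ)ᴴ) := by
          rw [h]; simp only [Matrix.mul_assoc]
      _ = 1 := by rw [e, Units.inv_mul, Matrix.one_mul]
  -- `W` is so far only a coisometry; cancelling the invertible M†M gives W†W = 1.
  refine ⟨W, h1, hM.mul_right_inj.mp ?_, hW⟩
  rw [Matrix.mul_one, Matrix.mul_assoc]
  congr 1
  calc M * (Wᴴ * W) = (u : Matrix ι ι ℂ) * (W * Wᴴ) * W := by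
        rw [hW]; simp only [Matrix.mul_assoc]
    _ = M := by rw [h1, Matrix.mul_one, ← hW]

theorem exists_isSourceSplitting {dA dB dE : ℕ} {ψ : Fin dA × Fin dB × Fin dE → ℂ}
    (hψ : IsUnitVec ψ) (hfull : LocallyFullRank (ketbra ψ))
    (hind : OperationallyIndependent (ketbra ψ)) :
    ∃ (kA kB : ℕ) (V : Matrix (Fin kA × Fin kB) (Fin dE) ℂ)
      (χA : Fin dA × Fin kA → ℂ) (χB : Fin dB × Fin kB → ℂ), IsSourceSplitting ψ V χA χB := by
  have hG := product_of_operationallyIndependent hfull.1.isHermitian hfull.2.1.isHermitian hind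
  have hM1 := (isUnitVec_iff_stateMatrix.mp hψ)
  have hA1 : (reducedA (ketbra ψ)).trace = 1 := by
    have := trace_kronecker_one_mul_reducedA ψ 1
    rwa [Matrix.one_kronecker_one, Matrix.one_mul, Matrix.one_mul, hM1, eq_comm] at this
  have hB1 : (reducedB (ketbra ψ)).trace = 1 := by
    have := trace_one_kronecker_mul_reducedB ψ 1
    rwa [Matrix.one_kronecker_one, Matrix.one_mul, Matrix.one_mul, hM1, eq_comm] at this
  obtain ⟨CA, hCA⟩ := exists_eq_conjTranspose_mul_self hfull.1.posSemidef
  obtain ⟨CB, hCB⟩ := exists_eq_conjTranspose_mul_self hfull.2.1.posSemidef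
  have hCAu : IsUnit CAᴴ := (isUnit_of_mul_isUnit_left (hCA ▸ hfull.1.isUnit))
  have hCBu : IsUnit CBᴴ := (isUnit_of_mul_isUnit_left (hCB ▸ hfull.2.1.isUnit))
  obtain ⟨W, hW1, hW2, hW⟩ := exists_unitary_of_mul_conjTranspose_eq
    (isUnit_stateMatrix_gram hfull.2.2) (Matrix.IsUnit.kronecker hCAu hCBu)
    (by rw [hG, hCA, hCB, Matrix.conjTranspose_kronecker, ← Matrix.mul_kronecker_mul,
      Matrix.conjTranspose_conjTranspose, Matrix.conjTranspose_conjTranspose])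
  -- Each source is the purification of its local state by a factor C† with ρ = C†C. Eve's unitary
  -- is the entrywise conjugate of `W`, so that its transpose W† undoes `W` on the right.
  refine ⟨dA, dB, Wᴴᵀ, fun p => CAᴴ p.1 p.2, fun p => CBᴴ p.1 p.2, ⟨?_, ?_⟩, ?_, ?_, ?_⟩
  · rw [conjTranspose_transpose_conjTranspose,
      ← Matrix.transpose_mul, hW1, Matrix.transpose_one]
  · rw [conjTranspose_transpose_conjTranspose,
      ← Matrix.transpose_mul, hW2, Matrix.transpose_one]
  · refine isUnitVec_iff_sourceMatrix.mpr ?_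
    change (CAᴴ * CAᴴᴴ).trace = 1
    rw [Matrix.conjTranspose_conjTranspose, ← hCA, hA1]
  · refine isUnitVec_iff_sourceMatrix.mpr ?_
    change (CBᴴ * CBᴴᴴ).trace = 1
    rw [Matrix.conjTranspose_conjTranspose, ← hCB, hB1]
  · refine stateMatrix_injective ?_
    rw [stateMatrix_mulVec, stateMatrix_sourcesVec, Matrix.one_kronecker_one, Matrix.one_mul,
      Matrix.transpose_transpose, hW, Matrix.mul_assoc, hW1, Matrix.mul_one]
    rfl

end Splitting

/-! ### From invariant product states to certified sources and mirrored operators. -/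

section Certification
variable {α β ε αb βb : Type*} [Fintype α] [Fintype β] [Fintype ε] [Fintype αb] [Fintype βb]
  [DecidableEq α] [DecidableEq β] [DecidableEq ε] [DecidableEq αb] [DecidableEq βb]

/-- Conjugation by an involution preserves the trace, so each partial trace isolates one factor: aRa
= R and zSz = S. -/
lemma commute_of_kronecker_invariant {a R : Matrix α α ℂ} {z S : Matrix β β ℂ}
    (ha : a * a = 1) (hz : z * z = 1) (hR : R.trace = 1) (hS : S.trace = 1)
    (h : (a ⊗ₖ z) * (R ⊗ₖ S) * (a ⊗ₖ z) = R ⊗ₖ S) : Commute a R ∧ Commute z S := by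
  rw [← Matrix.mul_kronecker_mul, ← Matrix.mul_kronecker_mul] at h
  have hR' : (a * R * a).trace = 1 := by rw [Matrix.trace_mul_comm, ← mul_assoc, ha, one_mul, hR]
  have hS' : (z * S * z).trace = 1 := by rw [Matrix.trace_mul_comm, ← mul_assoc, hz, one_mul, hS]
  have e1 : a * R * a = R := by
    ext i j
    have := Finset.sum_congr (s₁ := Finset.univ) rfl fun b (_ : b ∈ Finset.univ) =>
      congrFun (congrFun h (i, b)) (j, b)
    simp only [Matrix.kroneckerMap_apply, ← Finset.mul_sum] at this
    change _ * (z * S * z).trace = _ * S.trace at this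
    rwa [hS, hS', mul_one, mul_one] at this
  have e2 : z * S * z = S := by
    ext i j
    have := Finset.sum_congr (s₁ := Finset.univ) rfl fun b (_ : b ∈ Finset.univ) =>
      congrFun (congrFun h (b, i)) (b, j)
    simp only [Matrix.kroneckerMap_apply, ← Finset.sum_mul] at this
    change (a * R * a).trace * _ = R.trace * _ at this
    rwa [hR, hR', one_mul, one_mul] at this
  constructor
  · change a * R = R * a
    conv_rhs => rw [← e1]
    rw [mul_assoc _ a a, ha, mul_one]
  · change z * S = S * z
    conv_rhs => rw [← e2]
    rw [mul_assoc _ z z, hz, mul_one]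

/-- The determinant of a Kronecker product is a product of powers with the dimensions as exponents;
nonemptiness keeps the exponents nonzero. -/
lemma isUnit_gram_of_kronecker {X : Matrix α αb ℂ} {Y : Matrix β βb ℂ} [Nonempty αb] [Nonempty βb]
    (h : IsUnit ((X ⊗ₖ Y)ᴴ * (X ⊗ₖ Y))) : IsUnit (Xᴴ * X) ∧ IsUnit (Yᴴ * Y) := by
  rw [Matrix.conjTranspose_kronecker, ← Matrix.mul_kronecker_mul, Matrix.isUnit_iff_isUnit_det,
    Matrix.det_kronecker, IsUnit.mul_iff, isUnit_pow_iff Fintype.card_ne_zero,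
    isUnit_pow_iff Fintype.card_ne_zero] at h
  rwa [Matrix.isUnit_iff_isUnit_det, Matrix.isUnit_iff_isUnit_det]

lemma nonempty_of_isUnitVec {χ : α × αb → ℂ} (h : IsUnitVec χ) : Nonempty αb := by
  by_contra hn
  rw [not_nonempty_iff] at hn
  simp [IsUnitVec] at h

lemma phiPlus_apply (i j : Fin 2) :
    phiPlus (i, j) = ((√2 : ℝ) : ℂ)⁻¹ * (1 : Matrix (Fin 2) (Fin 2) ℂ) i j := by
  fin_cases i <;> fin_cases j <;> simp [phiPlus]

lemma kronecker_prodProdProdComm {κ₁ κ₂ κ₃ κ₄ : Type*}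
    (A : Matrix κ₁ κ₁ ℂ) (B : Matrix κ₂ κ₂ ℂ) (C : Matrix κ₃ κ₃ ℂ) (D : Matrix κ₄ κ₄ ℂ) :
    (A ⊗ₖ B) ⊗ₖ (C ⊗ₖ D) = ((A ⊗ₖ C) ⊗ₖ (B ⊗ₖ D)).submatrix
      (Equiv.prodProdProdComm κ₁ κ₂ κ₃ κ₄) (Equiv.prodProdProdComm κ₁ κ₂ κ₃ κ₄) := by
  ext ⟨⟨a, b⟩, c, d⟩ ⟨⟨a', b'⟩, c', d'⟩
  simp [mul_mul_mul_comm]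

lemma IsUnitaryMap.conj {κ ι : Type*} [Fintype κ] [Fintype ι] [DecidableEq κ] [DecidableEq ι]
    {Q : Matrix κ ι ℂ} (h : IsUnitaryMap Q) : IsUnitaryMap Qᴴᵀ := by
  constructor
  · rw [conjTranspose_transpose_conjTranspose,
      ← Matrix.transpose_mul, h.1, Matrix.transpose_one]
  · rw [conjTranspose_transpose_conjTranspose,
      ← Matrix.transpose_mul, h.2, Matrix.transpose_one]

lemma IsUnitaryMap.kronecker {κ ι κ' ι' : Type*} [Fintype κ] [Fintype ι] [DecidableEq κ]
    [DecidableEq ι] [Fintype κ'] [Fintype ι'] [DecidableEq κ'] [DecidableEq ι']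
    {P : Matrix κ ι ℂ} {Q : Matrix κ' ι' ℂ} (hP : IsUnitaryMap P) (hQ : IsUnitaryMap Q) :
    IsUnitaryMap (P ⊗ₖ Q) := by
  constructor <;>
  simp [Matrix.conjTranspose_kronecker, ← Matrix.mul_kronecker_mul, hP.1, hP.2, hQ.1, hQ.2]

lemma IsUnitaryMap.mul {κ ι μ : Type*} [Fintype κ] [Fintype ι] [DecidableEq κ] [DecidableEq ι]
    [Fintype μ] [DecidableEq μ] {P : Matrix κ ι ℂ} {Q : Matrix ι μ ℂ} (hP : IsUnitaryMap P)
    (hQ : IsUnitaryMap Q) : IsUnitaryMap (P * Q) := by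
  constructor
  · rw [Matrix.conjTranspose_mul, Matrix.mul_assoc, ← Matrix.mul_assoc Q, hQ.1, Matrix.one_mul,
      hP.1]
  · rw [Matrix.conjTranspose_mul, Matrix.mul_assoc, ← Matrix.mul_assoc Pᴴ, hP.2, Matrix.one_mul,
      hQ.2]

lemma sourceMatrix_kronecker_mulVec {κ κ' : Type*} (U : Matrix κ α ℂ) (W : Matrix κ' αb ℂ)
    (χ : α × αb → ℂ) : sourceMatrix ((U ⊗ₖ W) *ᵥ χ) = U * sourceMatrix χ * Wᵀ := by
  ext i j
  simp only [sourceMatrix, Matrix.of_apply, Matrix.mulVec, dotProduct, Matrix.mul_apply,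
    Fintype.sum_prod_type, Matrix.kroneckerMap_apply, Matrix.transpose_apply, Finset.sum_mul]
  refine Finset.sum_comm.trans ?_
  exact Finset.sum_congr rfl fun k _ => Finset.sum_congr rfl fun a _ => by ring

lemma certifiesSource_of_source_form {m n : ℕ} {χ : α × αb → ℂ} (hχ : IsUnitVec χ)
    {O : Fin 2 → Matrix α α ℂ} {T : Fin 2 → Matrix (Fin 2) (Fin 2) ℂ}
    {U : Matrix (Fin 2 × Fin m) α ℂ} {Q : Matrix (Fin 2 × Fin n) αb ℂ}
    {S : Matrix (Fin m) (Fin n) ℂ} (hU : IsUnitaryMap U) (hQ : IsUnitaryMap Q)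
    (hS : U * sourceMatrix χ * Qᴴ = (1 : Matrix (Fin 2) (Fin 2) ℂ) ⊗ₖ S)
    (hO : ∀ x, U * O x * Uᴴ = T x ⊗ₖ (1 : Matrix (Fin m) (Fin m) ℂ)) :
    CertifiesSource χ O T U Qᴴᵀ := by
  -- The coefficient matrix of |φ⁺⟩ is 1/√2 times the identity, so the factor √2 goes into the junk
  -- vector; it also normalizes that vector, since tr(1 ⊗ SS†) = 2 tr(SS†).
  refine ⟨hU, hQ.conj, ⟨fun p => √2 * S p.1 p.2, ?_, ?_⟩, hO⟩
  · have h1 := isUnitVec_iff_sourceMatrix.mp hχ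
    have h2 : ((U * sourceMatrix χ * Qᴴ) * (U * sourceMatrix χ * Qᴴ)ᴴ).trace = 1 := by
      rw [← h1]
      calc _ = (U * (sourceMatrix χ * (Qᴴ * Q) * (sourceMatrix χ)ᴴ * Uᴴ)).trace := by
            simp only [Matrix.conjTranspose_mul, Matrix.conjTranspose_conjTranspose,
              Matrix.mul_assoc]
        _ = _ := by
            rw [Matrix.trace_mul_comm, hQ.2, Matrix.mul_one, Matrix.mul_assoc, hU.2,
              Matrix.mul_one]
    rw [hS, Matrix.conjTranspose_kronecker, ← Matrix.mul_kronecker_mul, Matrix.trace_kronecker,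
      trace_mul_conjTranspose_self S, Matrix.conjTranspose_one, Matrix.mul_one,
      Matrix.trace_one, Fintype.card_fin] at h2
    have h3 : (2 : ℝ) * ∑ i, ∑ k, ‖S i k‖ ^ 2 = 1 := by exact_mod_cast h2
    rw [IsUnitVec, Fintype.sum_prod_type, ← h3, Finset.mul_sum]
    refine Finset.sum_congr rfl fun i _ => ?_
    rw [Finset.mul_sum]
    refine Finset.sum_congr rfl fun k _ => ?_
    rw [norm_mul, mul_pow, Complex.norm_real, Real.norm_of_nonneg (Real.sqrt_nonneg 2),
      Real.sq_sqrt (by norm_num)]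
  · have h := sourceMatrix_kronecker_mulVec U Qᴴᵀ χ
    rw [Matrix.transpose_transpose, hS] at h
    ext ⟨⟨i, k⟩, j, l⟩
    have r0 : ((√2 : ℝ) : ℂ) ≠ 0 := by
      exact_mod_cast (show √(2 : ℝ) ≠ 0 by positivity)
    refine (congrFun (congrFun h (i, k)) (j, l)).trans ?_
    simp only [Function.comp_apply, Equiv.prodProdProdComm_apply, tensorVec, phiPlus_apply,
      Matrix.kroneckerMap_apply]
    field_simp

lemma IsUnitaryMap.conj_pullback {κ ι : Type*} [Fintype κ] [Fintype ι] [DecidableEq κ]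
    [DecidableEq ι] {Q : Matrix κ ι ℂ} (hQ : IsUnitaryMap Q) (T : Matrix κ κ ℂ) :
    Q * (Qᴴ * T * Q) * Qᴴ = T := by
  calc _ = (Q * Qᴴ) * T * (Q * Qᴴ) := by simp only [Matrix.mul_assoc]
    _ = _ := by rw [hQ.1, Matrix.one_mul, Matrix.mul_one]

/-- Eve's operator that mirrors `a ⊗ z` on two sources is the product of the mirror images. -/
lemma mirrored_operator {KA : Matrix α αb ℂ} {KB : Matrix β βb ℂ}
    {M : Matrix (α × β) ε ℂ} {V : Matrix (αb × βb) ε ℂ} (hV : IsUnitaryMap V)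
    (hK : M * Vᵀ = KA ⊗ₖ KB) (hKu : IsUnit ((KA ⊗ₖ KB)ᴴ * (KA ⊗ₖ KB)))
    {a : Matrix α α ℂ} {z : Matrix β β ℂ} {F : Matrix ε ε ℂ} (hF : (a ⊗ₖ z) * M = M * Fᵀ)
    {m n : ℕ} {σ : Matrix (Fin 2) (Fin 2) ℂ} (hσ : σᵀ = σ)
    {QA : Matrix (Fin 2 × Fin m) αb ℂ} {QB : Matrix (Fin 2 × Fin n) βb ℂ}
    (hQA : IsUnitaryMap QA) (hQB : IsUnitaryMap QB)
    (ha : a * KA = KA * (QAᴴ * (σ ⊗ₖ (1 : Matrix (Fin m) (Fin m) ℂ)) * QA))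
    (hz : z * KB = KB * (QBᴴ * (σ ⊗ₖ (1 : Matrix (Fin n) (Fin n) ℂ)) * QB)) :
    ((QAᴴᵀ ⊗ₖ QBᴴᵀ) * V) * F * ((QAᴴᵀ ⊗ₖ QBᴴᵀ) * V)ᴴ =
      ((σ ⊗ₖ σ) ⊗ₖ (1 : Matrix (Fin m × Fin n) (Fin m × Fin n) ℂ)).submatrix
        (Equiv.prodProdProdComm (Fin 2) (Fin m) (Fin 2) (Fin n))
        (Equiv.prodProdProdComm (Fin 2) (Fin m) (Fin 2) (Fin n)) := by
  set K := KA ⊗ₖ KB with hKdef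
  set YA := QAᴴ * (σ ⊗ₖ (1 : Matrix (Fin m) (Fin m) ℂ)) * QA
  set YB := QBᴴ * (σ ⊗ₖ (1 : Matrix (Fin n) (Fin n) ℂ)) * QB
  have hVM : K * Vᴴᵀ = M := by
    rw [← hK, Matrix.mul_assoc, ← Matrix.transpose_mul, hV.2, Matrix.transpose_one, Matrix.mul_one]
  have h1 : K * (V * F * Vᴴ)ᵀ = K * (YA ⊗ₖ YB) := by
    calc K * (V * F * Vᴴ)ᵀ = (K * Vᴴᵀ) * Fᵀ * Vᵀ := by
          simp only [Matrix.transpose_mul, Matrix.mul_assoc]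
      _ = (a ⊗ₖ z) * K := by rw [hVM, ← hF, Matrix.mul_assoc, hK]
      _ = K * (YA ⊗ₖ YB) := by
          rw [hKdef, ← Matrix.mul_kronecker_mul, ha, hz, Matrix.mul_kronecker_mul]
  -- Injectivity of `K` means that an operator of Eve is determined by its action on the state.
  have h2 : (V * F * Vᴴ)ᵀ = YA ⊗ₖ YB := by
    refine hKu.mul_right_inj.mp ?_
    rw [Matrix.mul_assoc, h1, Matrix.mul_assoc]
  have h3 : (QA ⊗ₖ QB) * (V * F * Vᴴ)ᵀ * (QA ⊗ₖ QB)ᴴ =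
      (σ ⊗ₖ (1 : Matrix (Fin m) (Fin m) ℂ)) ⊗ₖ (σ ⊗ₖ (1 : Matrix (Fin n) (Fin n) ℂ)) := by
    rw [h2, Matrix.conjTranspose_kronecker, ← Matrix.mul_kronecker_mul,
      ← Matrix.mul_kronecker_mul, hQA.conj_pullback, hQB.conj_pullback]
  have hΩ : QAᴴᵀ ⊗ₖ QBᴴᵀ = (QA ⊗ₖ QB)ᴴᵀ := by
    rw [Matrix.conjTranspose_kronecker]; rfl
  rw [← Matrix.one_kronecker_one, ← kronecker_prodProdProdComm]
  calc _ = ((QA ⊗ₖ QB) * (V * F * Vᴴ)ᵀ * (QA ⊗ₖ QB)ᴴ)ᵀ := by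
        rw [hΩ, Matrix.conjTranspose_mul, conjTranspose_transpose_conjTranspose]
        simp only [Matrix.transpose_mul, Matrix.transpose_transpose, Matrix.mul_assoc]
    _ = _ := by
        rw [h3]
        ext ⟨⟨i, k⟩, j, l⟩ ⟨⟨i', k'⟩, j', l'⟩
        have hs (i j : Fin 2) : σ j i = σ i j := congrFun (congrFun hσ i) j
        simp [hs i i', hs j j', Matrix.one_apply, eq_comm]

end Certification

/-! ### Bell projections from parities, and the self-test. -/

lemma σz_transpose : σzᵀ = σz := by ext i j; fin_cases i <;> fin_cases j <;> rfl
lemma σx_transpose : σxᵀ = σx := by ext i j; fin_cases i <;> fin_cases j <;> rfl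

/-- The Bell vector is the joint eigenvector of σz ⊗ σz and σx ⊗ σx with signs (−1)^(i+j) and
(−1)^i. The right side has the same shape as `IdealRelations.eve`. -/
lemma bell_projection (e : Fin 4) :
    ketbra (bellVec (eveOutcome.symm e).1 (eveOutcome.symm e).2) =
      (4 : ℝ)⁻¹ • ((1 + signZ e • (σz ⊗ₖ σz)) * (1 + signX e • (σx ⊗ₖ σx))) := by
  have h0 : eveOutcome.symm 0 = (0, 0) := by decide
  have h1 : eveOutcome.symm 1 = (0, 1) := by decide
  have h2 : eveOutcome.symm 2 = (1, 0) := by decide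
  have h3 : eveOutcome.symm 3 = (1, 1) := by decide
  have hr : ((√2 : ℝ) : ℂ)⁻¹ * ((√2 : ℝ) : ℂ)⁻¹ = 2⁻¹ := by
    rw [← mul_inv, ← Complex.ofReal_mul, sqrt_two_mul_self]; norm_num
  ext ⟨i, j⟩ ⟨k, l⟩
  simp only [Matrix.smul_apply, Matrix.mul_apply, Fintype.sum_prod_type, Fin.sum_univ_two]
  fin_cases e <;> fin_cases i <;> fin_cases j <;> fin_cases k <;> fin_cases l <;>
    simp [h0, h1, h2, h3, ketbra, Matrix.vecMulVec_apply, bellVec, signZ, signX, σz, σx,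
      hr] <;> norm_num

section SelfTest
variable {α β ε αb βb : Type*} [Fintype α] [Fintype β] [Fintype ε] [Fintype αb] [Fintype βb]
  [DecidableEq α] [DecidableEq β] [DecidableEq ε] [DecidableEq αb] [DecidableEq βb]

lemma stateMatrix_parity {ψ : α × β × ε → ℂ} (hψ : IsUnitVec ψ) {a : Matrix α α ℂ}
    {z : Matrix β β ℂ} {F : Matrix ε ε ℂ}
    (h : opB α ε z * opA β ε a * ketbra ψ = opE α β F * ketbra ψ) :
    (a ⊗ₖ z) * stateMatrix ψ = stateMatrix ψ * Fᵀ := by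
  have h1 := congrArg stateMatrix (mulVec_eq_of_mul_ketbra_eq hψ h)
  rw [← (commute_opA_opB a z).eq, ← mul_one (opA β ε a * opB α ε z), ← opE_one,
    opA_mul_opB_mul_opE, opE, stateMatrix_mulVec, stateMatrix_mulVec, Matrix.one_kronecker_one,
    Matrix.one_mul, Matrix.transpose_one, Matrix.mul_one] at h1
  exact h1

lemma parity_invariant {M : Matrix (α × β) ε ℂ} {a : Matrix α α ℂ} {z : Matrix β β ℂ}
    {F : Matrix ε ε ℂ} (ha : a.IsHermitian) (hz : z.IsHermitian) (hF : F.IsHermitian)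
    (hFF : F * F = 1) (h : (a ⊗ₖ z) * M = M * Fᵀ) :
    (a ⊗ₖ z) * (M * Mᴴ) * (a ⊗ₖ z) = M * Mᴴ := by
  have haz : (a ⊗ₖ z)ᴴ = a ⊗ₖ z := by rw [Matrix.conjTranspose_kronecker, ha.eq, hz.eq]
  have hFt : Fᵀᴴ = Fᵀ := by
    have := congrArg Matrix.transpose hF.eq
    rwa [show Fᴴᵀ = Fᵀᴴ from rfl] at this
  calc (a ⊗ₖ z) * (M * Mᴴ) * (a ⊗ₖ z) = ((a ⊗ₖ z) * M) * ((a ⊗ₖ z) * M)ᴴ := by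
        rw [Matrix.conjTranspose_mul, haz]; simp only [Matrix.mul_assoc]
    _ = M * (F * F)ᵀ * Mᴴ := by
        rw [h, Matrix.conjTranspose_mul, hFt, Matrix.transpose_mul]; simp only [Matrix.mul_assoc]
    _ = M * Mᴴ := by rw [hFF, Matrix.transpose_one, Matrix.mul_one]

lemma IsUnitaryMap.conj_mul {κ ι : Type*} [Fintype κ] [Fintype ι] [DecidableEq κ]
    [DecidableEq ι] {Ω : Matrix κ ι ℂ} (h : IsUnitaryMap Ω) (X Y : Matrix ι ι ℂ) :
    Ω * (X * Y) * Ωᴴ = (Ω * X * Ωᴴ) * (Ω * Y * Ωᴴ) := by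
  calc _ = Ω * X * (1 : Matrix ι ι ℂ) * Y * Ωᴴ := by rw [Matrix.mul_one, ← Matrix.mul_assoc]
    _ = _ := by rw [← h.2]; simp only [Matrix.mul_assoc]

lemma IsUnitaryMap.conj_one_add_smul {κ ι : Type*} [Fintype κ] [Fintype ι] [DecidableEq κ]
    [DecidableEq ι] {Ω : Matrix κ ι ℂ} (h : IsUnitaryMap Ω) (s : ℝ) (X : Matrix ι ι ℂ) :
    Ω * (1 + s • X) * Ωᴴ = 1 + s • (Ω * X * Ωᴴ) := by
  rw [Matrix.mul_add, Matrix.mul_one, Matrix.add_mul, h.1, Matrix.mul_smul, Matrix.smul_mul]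

lemma obsZ_isHermitian {D : Devices α β ε} (hD : D.IsValid) : D.obsZ.IsHermitian :=
  isHermitian_real_smul _ ((obsB_isHermitian hD 0).sub (obsB_isHermitian hD 1))

lemma obsX_isHermitian {D : Devices α β ε} (hD : D.IsValid) : D.obsX.IsHermitian :=
  isHermitian_real_smul _ ((obsB_isHermitian hD 0).add (obsB_isHermitian hD 1))

lemma obsB_eq (D : Devices α β ε) :
    D.obsB = ![(√2)⁻¹ • (D.obsZ + D.obsX), (√2)⁻¹ • (D.obsX - D.obsZ)] := by
  have h : (√2)⁻¹ * (√2)⁻¹ = (2 : ℝ)⁻¹ := by rw [← mul_inv, sqrt_two_mul_self]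
  ext y : 1
  fin_cases y <;>
    simp only [Fin.zero_eta, Fin.mk_one, Matrix.cons_val_zero, Matrix.cons_val_one,
      Matrix.cons_val_fin_one, Devices.obsZ, Devices.obsX, ← smul_add, ← smul_sub, smul_smul, h] <;>
    module

theorem certification {ψ : α × β × ε → ℂ} {D : Devices α β ε} (hψ : IsUnitVec ψ)
    (hD : D.IsValid) (hfull : LocallyFullRank (ketbra ψ)) (hrel : IdealRelations (ketbra ψ) D)
    {V : Matrix (αb × βb) ε ℂ} {χA : α × αb → ℂ} {χB : β × βb → ℂ}
    (hsplit : IsSourceSplitting ψ V χA χB) :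
    ∃ (mA mAb mB mBb : ℕ)
      (UA : Matrix (Fin 2 × Fin mA) α ℂ) (UAb : Matrix (Fin 2 × Fin mAb) αb ℂ)
      (UB : Matrix (Fin 2 × Fin mB) β ℂ) (UBb : Matrix (Fin 2 × Fin mBb) βb ℂ),
      CertifiesSource χA D.obsA idealA UA UAb ∧ CertifiesSource χB D.obsB idealB UB UBb ∧
        CertifiesEve D.NE V UAb UBb := by
  obtain ⟨hV, hχA, hχB, hprod⟩ := hsplit
  have := nonempty_of_isUnitVec hχA
  have := nonempty_of_isUnitVec hχB
  have hA1 := isUnitVec_iff_sourceMatrix.mp hχA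
  have hB1 := isUnitVec_iff_sourceMatrix.mp hχB
  have hK := congrArg stateMatrix hprod
  rw [stateMatrix_mulVec, stateMatrix_sourcesVec, Matrix.one_kronecker_one, Matrix.one_mul] at hK
  have hVt : Vᵀ * Vᴴᵀ = 1 := by rw [← Matrix.transpose_mul, hV.2, Matrix.transpose_one]
  have hVt' : Vᴴᵀ * Vᵀ = 1 := by rw [← Matrix.transpose_mul, hV.1, Matrix.transpose_one]
  have hG : stateMatrix ψ * (stateMatrix ψ)ᴴ =
      (sourceMatrix χA * (sourceMatrix χA)ᴴ) ⊗ₖ (sourceMatrix χB * (sourceMatrix χB)ᴴ) := by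
    rw [Matrix.mul_kronecker_mul, ← Matrix.conjTranspose_kronecker, ← hK,
      Matrix.conjTranspose_mul, Matrix.mul_assoc, ← Matrix.mul_assoc Vᵀ,
      show Vᵀᴴ = Vᴴᵀ from rfl, hVt, Matrix.one_mul]
  have hKu : IsUnit ((sourceMatrix χA ⊗ₖ sourceMatrix χB)ᴴ *
      (sourceMatrix χA ⊗ₖ sourceMatrix χB)) := by
    obtain ⟨u, hu⟩ := isUnit_stateMatrix_gram hfull.2.2
    -- The Gram matrix of the sources is that of the state conjugated by the unitary Vᵀ, which gives
    -- its inverse.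
    refine IsUnit.of_mul_eq_one (Vᴴᵀ * (↑u⁻¹ : Matrix ε ε ℂ) * Vᵀ) ?_
    rw [← hK, Matrix.conjTranspose_mul, show Vᵀᴴ = Vᴴᵀ from rfl]
    calc _ = Vᴴᵀ * ((stateMatrix ψ)ᴴ * stateMatrix ψ) * (Vᵀ * Vᴴᵀ) * (↑u⁻¹ : Matrix ε ε ℂ) * Vᵀ := by
          simp only [Matrix.mul_assoc]
      _ = 1 := by
          rw [hVt, Matrix.mul_one, ← hu, Matrix.mul_assoc Vᴴᵀ, Units.mul_inv, Matrix.mul_one, hVt']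
  obtain ⟨hAl, hBl⟩ := isUnit_gram_of_kronecker hKu
  have hRA : reducedA (ketbra ψ) = sourceMatrix χA * (sourceMatrix χA)ᴴ := by
    ext a a'
    simp only [reducedA_ketbra, hG, Matrix.kroneckerMap_apply, ← Finset.mul_sum]
    exact (congrArg _ hB1).trans (mul_one _)
  have hRB : reducedB (ketbra ψ) = sourceMatrix χB * (sourceMatrix χB)ᴴ := by
    ext b b'
    simp only [reducedB_ketbra, hG, Matrix.kroneckerMap_apply, ← Finset.sum_mul]
    exact (congrArg (· * _) hA1).trans (one_mul _)
  have hZ := stateMatrix_parity hψ hrel.parityZ_mul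
  have hX := stateMatrix_parity hψ hrel.parityX_mul
  have hZh := obsZ_isHermitian hD
  have hXh := obsX_isHermitian hD
  have hpZ : D.parityZ.IsHermitian := isHermitian_sum_smul_povm hD.2.2 _
  have hpX : D.parityX.IsHermitian := isHermitian_sum_smul_povm hD.2.2 _
  have iZ := parity_invariant (obsA_isHermitian hD 0) hZh hpZ hrel.parityZ_sq hZ
  have iX := parity_invariant (obsA_isHermitian hD 1) hXh hpX hrel.parityX_sq hX
  rw [hG] at iZ iX
  obtain ⟨cA0, cZ⟩ := commute_of_kronecker_invariant (hrel.obsA_sq 0) hrel.obsZ_sq hA1 hB1 iZ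
  obtain ⟨cA1, cX⟩ := commute_of_kronecker_invariant (hrel.obsA_sq 1) hrel.obsX_sq hA1 hB1 iX
  obtain ⟨mA, mAb, UA, QA, SA, hUA, hQA, hUA0, hUA1, hSA, hmA0, hmA1⟩ :=
    exists_source_form hAl (hRA ▸ hfull.1.isUnit) (obsA_isHermitian hD 0) (obsA_isHermitian hD 1)
      (hrel.obsA_sq 0) (hrel.obsA_sq 1) hrel.obsA_anticomm cA0 cA1
  obtain ⟨mB, mBb, UB, QB, SB, hUB, hQB, hUB0, hUB1, hSB, hmB0, hmB1⟩ :=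
    exists_source_form hBl (hRB ▸ hfull.2.1.isUnit) hZh hXh hrel.obsZ_sq hrel.obsX_sq
      hrel.obsB_anticomm cZ cX
  refine ⟨mA, mAb, mB, mBb, UA, QAᴴᵀ, UB, QBᴴᵀ,
    certifiesSource_of_source_form hχA hUA hQA hSA ?_,
    certifiesSource_of_source_form hχB hUB hQB hSB ?_, ?_⟩
  · intro x
    fin_cases x
    · exact hUA0
    · exact hUA1
  · intro y
    -- Bob's Pauli pair is Z, X rather than B₀, B₁; his observables are recovered by linearity.
    rw [obsB_eq]
    fin_cases y
    · simp only [Fin.zero_eta, Matrix.cons_val_zero, Matrix.mul_smul, Matrix.smul_mul,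
        Matrix.mul_add, Matrix.add_mul, hUB0, hUB1, idealB]
      ext ⟨i, k⟩ ⟨j, l⟩
      simp [add_mul, mul_assoc]
    · simp only [Fin.mk_one, Matrix.cons_val_one, Matrix.cons_val_fin_one, Matrix.mul_smul,
        Matrix.smul_mul, Matrix.mul_sub, Matrix.sub_mul, hUB0, hUB1, idealB]
      ext ⟨i, k⟩ ⟨j, l⟩
      simp [sub_mul, mul_sub, mul_assoc]
  · intro i j
    have hΩ : IsUnitaryMap ((QAᴴᵀ ⊗ₖ QBᴴᵀ) * V) := (hQA.conj.kronecker hQB.conj).mul hV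
    have hb := bell_projection (eveOutcome (i, j))
    rw [Equiv.symm_apply_apply] at hb
    rw [hrel.eve, Matrix.mul_smul, Matrix.smul_mul, hΩ.conj_mul, hΩ.conj_one_add_smul,
      hΩ.conj_one_add_smul, mirrored_operator hV hK hKu hZ σz_transpose hQA hQB hmA0 hmB0,
      mirrored_operator hV hK hKu hX σx_transpose hQA hQB hmA1 hmB1, hb]
    have hk (X Y : Matrix (Fin 2 × Fin 2) (Fin 2 × Fin 2) ℂ) :
        (X * Y) ⊗ₖ (1 : Matrix (Fin mAb × Fin mBb) (Fin mAb × Fin mBb) ℂ) =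
          (X ⊗ₖ 1) * (Y ⊗ₖ 1) := by rw [← Matrix.mul_kronecker_mul, Matrix.one_mul]
    simp only [Matrix.smul_kronecker, hk, Matrix.add_kronecker, Matrix.one_kronecker_one,
      Matrix.submatrix_smul, Matrix.submatrix_add, Pi.smul_apply, Pi.add_apply,
      ← Matrix.submatrix_mul_equiv _ _ _
        (Equiv.prodProdProdComm (Fin 2) (Fin mAb) (Fin 2) (Fin mBb)),
      Matrix.submatrix_one_equiv]

end SelfTest

/-! ### The ideal strategy attains the bound. -/

section Ideal

lemma phiPlus_sourceMatrix :
    sourceMatrix phiPlus = ((√2 : ℝ) : ℂ)⁻¹ • (1 : Matrix (Fin 2) (Fin 2) ℂ) := by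
  ext i j
  simpa [sourceMatrix] using phiPlus_apply i j

lemma inv_sqrt_two_mul_self : ((√2 : ℝ) : ℂ)⁻¹ * ((√2 : ℝ) : ℂ)⁻¹ = 2⁻¹ := by
  rw [← mul_inv, ← Complex.ofReal_mul, sqrt_two_mul_self]; norm_num

lemma phiPlus_gram :
    sourceMatrix phiPlus * (sourceMatrix phiPlus)ᴴ =
      (2⁻¹ : ℂ) • (1 : Matrix (Fin 2) (Fin 2) ℂ) := by
  rw [phiPlus_sourceMatrix, Matrix.conjTranspose_smul, smul_mul_assoc, mul_smul_comm, smul_smul,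
    Matrix.conjTranspose_one, Matrix.one_mul, star_inv₀]
  simp [inv_sqrt_two_mul_self]

lemma trace_phiPlus_gram : (sourceMatrix phiPlus * (sourceMatrix phiPlus)ᴴ).trace = 1 := by
  rw [phiPlus_gram]; simp

lemma sources_gram {α β αb βb : Type*} [Fintype α] [Fintype β] [Fintype αb] [Fintype βb]
    [DecidableEq α] [DecidableEq β] [DecidableEq αb] [DecidableEq βb]
    (χA : α × αb → ℂ) (χB : β × βb → ℂ) :
    stateMatrix (sourcesVec χA χB) * (stateMatrix (sourcesVec χA χB))ᴴ =
      (sourceMatrix χA * (sourceMatrix χA)ᴴ) ⊗ₖ (sourceMatrix χB * (sourceMatrix χB)ᴴ) := by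
  rw [stateMatrix_sourcesVec, Matrix.conjTranspose_kronecker, ← Matrix.mul_kronecker_mul]

lemma idealState_isUnitVec : IsUnitVec (sourcesVec phiPlus phiPlus) := by
  rw [isUnitVec_iff_stateMatrix, sources_gram, Matrix.trace_kronecker, trace_phiPlus_gram, mul_one]

lemma idealState_isState : IsState idealState := isState_ketbra idealState_isUnitVec

lemma idealState_operationallyIndependent : OperationallyIndependent idealState :=
  operationallyIndependent_of_product (Matrix.isHermitian_mul_conjTranspose_self _)
    trace_phiPlus_gram trace_phiPlus_gram (sources_gram _ _)

lemma isPOVM_of_involution {O : Matrix (Fin 2) (Fin 2) ℂ} (hO : O.IsHermitian)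
    (hOO : O * O = 1) :
    IsPOVM fun a : Fin 2 => (2⁻¹ : ℂ) • (1 + (-1 : ℂ) ^ (a : ℕ) • O) := by
  have hP : ((2⁻¹ : ℝ) • (1 + O)).IsHermitian :=
    isHermitian_real_smul _ (Matrix.isHermitian_one.add hO)
  have hPP : ((2⁻¹ : ℝ) • (1 + O)) * ((2⁻¹ : ℝ) • (1 + O)) = (2⁻¹ : ℝ) • (1 + O) := by
    simp only [smul_mul_assoc, mul_smul_comm, mul_add, add_mul, hOO, mul_one, one_mul]
    module
  convert isPOVM_projection hP hPP using 1
  ext a i j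
  fin_cases a <;> simp <;> ring

lemma σz_isHermitian : σz.IsHermitian := by
  ext i j; fin_cases i <;> fin_cases j <;> simp [σz]

lemma σx_isHermitian : σx.IsHermitian := by
  ext i j; fin_cases i <;> fin_cases j <;> simp [σx]

lemma σz_mul_self : σz * σz = 1 := by
  ext i j; fin_cases i <;> fin_cases j <;> simp [σz]

lemma σx_mul_self : σx * σx = 1 := by
  ext i j; fin_cases i <;> fin_cases j <;> simp [σx]

lemma σz_mul_σx : σz * σx = -(σx * σz) := by
  ext i j; fin_cases i <;> fin_cases j <;> simp [σx, σz]

lemma idealA_isHermitian (x : Fin 2) : (idealA x).IsHermitian := by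
  fin_cases x
  · exact σz_isHermitian
  · exact σx_isHermitian

lemma idealA_mul_self (x : Fin 2) : idealA x * idealA x = 1 := by
  fin_cases x
  · exact σz_mul_self
  · exact σx_mul_self

lemma idealB_isHermitian (y : Fin 2) : (idealB y).IsHermitian := by
  fin_cases y
  · simp [idealB, Matrix.IsHermitian, Matrix.conjTranspose_smul, σz_isHermitian.eq,
      σx_isHermitian.eq]
  · simp [idealB, Matrix.IsHermitian, Matrix.conjTranspose_smul, σz_isHermitian.eq,
      σx_isHermitian.eq]

lemma idealB_mul_self (y : Fin 2) : idealB y * idealB y = 1 := by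
  fin_cases y
  · change ((√2 : ℝ) : ℂ)⁻¹ • (σz + σx) * ((√2 : ℝ) : ℂ)⁻¹ • (σz + σx) = 1
    rw [smul_mul_assoc, mul_smul_comm, smul_smul, inv_sqrt_two_mul_self, mul_add, add_mul,
      add_mul, σz_mul_self, σx_mul_self, σz_mul_σx]
    module
  · change ((√2 : ℝ) : ℂ)⁻¹ • (σx - σz) * ((√2 : ℝ) : ℂ)⁻¹ • (σx - σz) = 1
    rw [smul_mul_assoc, mul_smul_comm, smul_smul, inv_sqrt_two_mul_self, mul_sub, sub_mul,
      sub_mul, σz_mul_self, σx_mul_self, σz_mul_σx]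
    module

lemma idealDevices_NE_isPOVM : IsPOVM idealDevices.NE := by
  refine ⟨fun e => Matrix.posSemidef_vecMulVec_self_star _, ?_⟩
  simp only [idealDevices, bell_projection, Fin.sum_univ_four, signZ, signX, mul_add, add_mul,
    mul_one, one_mul, smul_mul_assoc, mul_smul_comm, Matrix.cons_val]
  module

lemma idealDevices_isValid : idealDevices.IsValid :=
  ⟨fun x => isPOVM_of_involution (idealA_isHermitian x) (idealA_mul_self x),
    fun y => isPOVM_of_involution (idealB_isHermitian y) (idealB_mul_self y),
    idealDevices_NE_isPOVM⟩

lemma idealDevices_obsA (x : Fin 2) : idealDevices.obsA x = idealA x := by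
  simp only [Devices.obsA, idealDevices, Fin.val_zero, Fin.val_one, pow_zero, pow_one]
  module

lemma idealDevices_obsB (y : Fin 2) : idealDevices.obsB y = idealB y := by
  simp only [Devices.obsB, idealDevices, Fin.val_zero, Fin.val_one, pow_zero, pow_one]
  module

/-- Across the cut AB|E the two pairs have coefficient matrix 1/2, so the expectation is a plain
trace against Eve's transposed element. -/
lemma expectation_ideal (x y : Fin 2) (e : Fin 4) :
    expectation (correlations idealState idealDevices) x y e =
      4⁻¹ * ((idealA x ⊗ₖ idealB y) * (idealDevices.NE e)ᵀ).trace.re := by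
  rw [expectation_correlations, opA_mul_opB_mul_opE, idealDevices_obsA, idealDevices_obsB]
  change born idealState _ _ _ = _
  have h : stateMatrix (sourcesVec phiPlus phiPlus) =
      (2⁻¹ : ℂ) • (1 : Matrix (Fin 2 × Fin 2) (Fin 2 × Fin 2) ℂ) := by
    rw [stateMatrix_sourcesVec, phiPlus_sourceMatrix, Matrix.smul_kronecker,
      Matrix.kronecker_smul, smul_smul, inv_sqrt_two_mul_self, Matrix.one_kronecker_one]
  rw [idealState, born_ketbra, h]
  simp only [Matrix.conjTranspose_smul, Matrix.conjTranspose_one, mul_smul_comm, mul_one,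
    smul_mul_assoc, smul_smul, Matrix.trace_smul]
  rw [show (star (2⁻¹ : ℂ) * 2⁻¹) = ((4⁻¹ : ℝ) : ℂ) by simp; norm_num, smul_eq_mul,
    Complex.re_ofReal_mul]

lemma trace_ideal_bell (x y : Fin 2) (e : Fin 4) :
    ((idealA x ⊗ₖ idealB y) * (idealDevices.NE e)ᵀ).trace.re =
      √2 / 2 * ![signZ e * ![1, -1] y, signX e] x := by
  simp only [idealDevices, bell_projection, Matrix.trace, Matrix.diag_apply, Matrix.mul_apply,
    Matrix.transpose_apply, Matrix.smul_apply, Fintype.sum_prod_type, Fin.sum_univ_two]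
  fin_cases x <;> fin_cases y <;> fin_cases e <;>
    simp [idealA, idealB, signZ, signX, σz, σx] <;> ring

lemma functionalI_ideal : functionalI (correlations idealState idealDevices) = 2 * √2 := by
  simp only [functionalI, expectation_ideal, trace_ideal_bell, Fin.sum_univ_four, signZ, signX]
  simp
  ring

end Ideal

/-! ### Transport of Eve's index type to `Fin dE`. -/

section Reindex
variable {dA dB dE : ℕ} {ε : Type*} [Fintype ε] [DecidableEq ε]

lemma trace_submatrix_equiv {ι κ : Type*} [Fintype ι] [Fintype κ] (X : Matrix ι ι ℂ) (f : κ ≃ ι) :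
    (X.submatrix f f).trace = X.trace :=
  f.sum_comp fun i => X i i

/-- Quantum correlations may use any finite index type for Eve's system. -/
lemma correlations_mem_quantumCorrelations (f : Fin dE ≃ ε)
    {ρ : Matrix (Fin dA × Fin dB × ε) (Fin dA × Fin dB × ε) ℂ} {D : Devices (Fin dA) (Fin dB) ε}
    (hρ : IsState ρ) (hD : D.IsValid) : correlations ρ D ∈ quantumCorrelations := by
  let F : Fin dA × Fin dB × Fin dE ≃ Fin dA × Fin dB × ε :=
    (Equiv.refl _).prodCongr ((Equiv.refl _).prodCongr f)
  refine ⟨dA, dB, dE, ρ.submatrix F F, ⟨D.NA, D.NB, fun e => (D.NE e).submatrix f f⟩,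
    ⟨hρ.1.submatrix F, ?_⟩, ⟨hD.1, hD.2.1, fun e => (hD.2.2.1 e).submatrix f, ?_⟩, ?_⟩
  · rw [trace_submatrix_equiv, hρ.2]
  · have h := congrArg (fun X => X.submatrix f f) hD.2.2.2
    ext i j
    have hij := congrFun (congrFun h i) j
    simpa [Matrix.sum_apply, Matrix.one_apply] using hij
  · ext a b e x y
    have h : D.NA x a ⊗ₖ (D.NB y b ⊗ₖ (D.NE e).submatrix f f) =
        (D.NA x a ⊗ₖ (D.NB y b ⊗ₖ D.NE e)).submatrix F F := rfl
    rw [correlations, correlations, born, born, h, Matrix.submatrix_mul_equiv,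
      trace_submatrix_equiv]

end Reindex

end WeakBilocality



theorem theorem1 :
    -- the quantum maximum
    IsGreatest (WeakBilocality.functionalI '' WeakBilocality.quantumCorrelations) (2 * √2) ∧
    -- it is reached by two maximally entangled pairs and the ideal measurements
    (WeakBilocality.IsState WeakBilocality.idealState ∧
      WeakBilocality.idealDevices.IsValid ∧
      WeakBilocality.OperationallyIndependent WeakBilocality.idealState ∧
      (∀ x, WeakBilocality.idealDevices.obsA x = WeakBilocality.idealA x) ∧
      (∀ y, WeakBilocality.idealDevices.obsB y = WeakBilocality.idealB y) ∧
      WeakBilocality.functionalI (WeakBilocality.correlations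
        WeakBilocality.idealState WeakBilocality.idealDevices) = 2 * √2) ∧
    -- self-testing
    (∀ (dA dB dE : ℕ) (ψ : Fin dA × Fin dB × Fin dE → ℂ)
      (D : WeakBilocality.Devices (Fin dA) (Fin dB) (Fin dE)),
      WeakBilocality.IsUnitVec ψ → D.IsValid →
      WeakBilocality.LocallyFullRank (WeakBilocality.ketbra ψ) →
      WeakBilocality.OperationallyIndependent (WeakBilocality.ketbra ψ) →
      WeakBilocality.functionalI
        (WeakBilocality.correlations (WeakBilocality.ketbra ψ) D) = 2 * √2 →
      -- the sources are independent
      (∃ (kA kB : ℕ) (V : Matrix (Fin kA × Fin kB) (Fin dE) ℂ)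
        (χA : Fin dA × Fin kA → ℂ) (χB : Fin dB × Fin kB → ℂ),
        WeakBilocality.IsSourceSplitting ψ V χA χB) ∧
      -- their states and all measurements are certified
      (∀ (kA kB : ℕ) (V : Matrix (Fin kA × Fin kB) (Fin dE) ℂ)
        (χA : Fin dA × Fin kA → ℂ) (χB : Fin dB × Fin kB → ℂ),
        WeakBilocality.IsSourceSplitting ψ V χA χB →
        ∃ (mA mAb mB mBb : ℕ)
          (UA : Matrix (Fin 2 × Fin mA) (Fin dA) ℂ) (UAb : Matrix (Fin 2 × Fin mAb) (Fin kA) ℂ)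
          (UB : Matrix (Fin 2 × Fin mB) (Fin dB) ℂ) (UBb : Matrix (Fin 2 × Fin mBb) (Fin kB) ℂ),
          WeakBilocality.CertifiesSource χA D.obsA WeakBilocality.idealA UA UAb ∧
          WeakBilocality.CertifiesSource χB D.obsB WeakBilocality.idealB UB UBb ∧
          WeakBilocality.CertifiesEve D.NE V UAb UBb)) := by
  refine ⟨⟨⟨_, WeakBilocality.correlations_mem_quantumCorrelations finProdFinEquiv.symm
      WeakBilocality.idealState_isState WeakBilocality.idealDevices_isValid,
      WeakBilocality.functionalI_ideal⟩, ?_⟩,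
    ⟨WeakBilocality.idealState_isState, WeakBilocality.idealDevices_isValid,
      WeakBilocality.idealState_operationallyIndependent, WeakBilocality.idealDevices_obsA,
      WeakBilocality.idealDevices_obsB, WeakBilocality.functionalI_ideal⟩, ?_⟩
  · rintro _ ⟨_, ⟨dA, dB, dE, ρ, D, hρ, hD, rfl⟩, rfl⟩
    exact WeakBilocality.functionalI_le hρ hD
  · intro dA dB dE ψ D hψ hD hfull hind hI
    refine ⟨WeakBilocality.exists_isSourceSplitting hψ hfull hind,
      fun kA kB V χA χB hsplit => WeakBilocality.certification hψ hD hfull ?_ hsplit⟩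
    exact WeakBilocality.idealRelations_of_saturation (WeakBilocality.isState_ketbra hψ) hfull hD hI
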